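/- **Conventions.** Let $\mathbb O=\mathbb H\oplus\mathbb H$ be the octonions, with multiplication $(q_1,q_2)(p_1,p_2)=(q_1p_1-\bar p_2q_2,\;p_2q_1+q_2\bar p_1)$, conjugation $\overline{(q_1,q_2)}=(\bar q_1,-q_2)$, real part $\mathrm{Re}(q_1,q_2)=\mathrm{Re}\,q_1$ and norm $|a|^2=\mathrm{Re}(a\bar a)$. In $\mathbb O^3$ let $$U_1=\{(1,u,v): 1+|u|^2-|v|^2>0\},\qquad U_2=\{(u,1,v): |u|^2+1-|v|^2>0\}.$$ Write $(a,b,c)\sim(d,e,f)$ if $a=d\lambda$, $b=e\lambda$, $c=f\lambda$ for some $\lambda\in\mathbb O\setminus\{0\}$; this is an equivalence relation on $U_1\cup U_2$. The indefinite octonionic projective plane is the quotient $\mathbb OP^{(1,1)}=(U_1\cup U_2)/{\sim}$, with the quotient topology. It is a smooth $16$-dimensional manifold with the two charts $[1,u,v]\mapsto(u,v)$ on $U_1/{\sim}$ and $[u,1,v]\mapsto(u,v)$ on $U_2/{\sim}$. Let $U_3/{\sim}\subset\mathbb OP^{(1,1)}$ be the set of classes $[a,b,c]$ with $c\neq0$;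 its points are written $[x,y,1]$ with $x=ac^{-1}$, $y=bc^{-1}$, and $(x,y)$ ranges over $|x|^2+|y|^2>1$. An isometry of a semi-Riemannian manifold is a diffeomorphism of it onto itself whose differential preserves the metric. **Theorem.** 1. There is one and only one smooth semi-Riemannian metric (smooth field of symmetric nondegenerate bilinear forms on the tangent spaces) on $\mathbb OP^{(1,1)}$ which in each of the two charts $U_1/{\sim}$ and $U_2/{\sim}$, with coordinates $(u,v)$, is given by $$ds^2=\frac{|du|^2(1-|v|^2)-|dv|^2(1+|u|^2)+2\,\mathrm{Re}[(u\bar v)(dv\,d\bar u)]}{(1+|u|^2-|v|^2)^2}.$$ It has signature $(8,8)$ at every point. 2. For $r\in\mathbb R$ and $\lambda\in\mathbb O$ with $r^2-|\lambda|^2=1$, the "indefinite reflection" $(u,v)\mapsto(-ru+\lambda v,\;-\bar\lambda u+rv)$ of $U_1/{\sim}$, and likewise that of $U_2/{\sim}$, extends to one and only one isometry of $\mathbb OP^{(1,1)}$, and this isometry is an involution. For $r\in\mathbb R$ and $\lambda\in\mathbb O$ with $r^2+|\lambda|^2=1$, the "Euclidean reflection" $[x,y,1]\mapsto[rx+\lambda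 y,\;\bar\lambda x-ry,\;1]$ of $U_3/{\sim}$ extends to one and only one isometry of $\mathbb OP^{(1,1)}$, and this isometry is an involution. 3. The group generated by the isometries in part 2 acts transitively on $\mathbb OP^{(1,1)}$. In particular $\mathbb OP^{(1,1)}$ is homogeneous: its isometry group acts transitively. -/

import Mathlib

open scoped Quaternion Manifold ContDiff

noncomputable section

/-- The octonions as pairs of quaternions. The Euclidean structure on `ℍ ⊕ ℍ` is the one with
`|(q₁, q₂)|² = |q₁|² + |q₂|²`. -/
def Octonion : Type := WithLp 2 (ℍ[ℝ] × ℍ[ℝ])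

namespace Octonion

instance : NormedAddCommGroup Octonion := inferInstanceAs (NormedAddCommGroup (WithLp 2 (ℍ[ℝ] × ℍ[ℝ])))
instance : InnerProductSpace ℝ Octonion := inferInstanceAs (InnerProductSpace ℝ (WithLp 2 (ℍ[ℝ] × ℍ[ℝ])))
instance : FiniteDimensional ℝ Octonion :=
  inferInstanceAs (FiniteDimensional ℝ (WithLp 2 (ℍ[ℝ] × ℍ[ℝ])))

def mk (p q : ℍ[ℝ]) : Octonion := WithLp.toLp 2 (p, q)
def fst (a : Octonion) : ℍ[ℝ] := (WithLp.ofLp a).1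
def snd (a : Octonion) : ℍ[ℝ] := (WithLp.ofLp a).2

/-- Cayley–Dickson multiplication. -/
instance : Mul Octonion :=
  ⟨fun a b => mk (a.fst * b.fst - star b.snd * a.snd) (b.snd * a.fst + a.snd * star b.fst)⟩
instance : One Octonion := ⟨mk 1 0⟩
/-- Octonionic conjugation. -/
def conj (a : Octonion) : Octonion := mk (star a.fst) (-a.snd)
/-- The real part. -/
def re (a : Octonion) : ℝ := a.fst.re
/-- The inverse `a⁻¹ = |a|⁻² ā` (with `0⁻¹ = 0`). -/
instance : Inv Octonion := ⟨fun a => (‖a‖ ^ 2)⁻¹ • a.conj⟩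

theorem inv_def (a : Octonion) : a⁻¹ = (‖a‖ ^ 2)⁻¹ • a.conj := rfl

theorem ext' {a b : Octonion} (h₁ : a.fst = b.fst) (h₂ : a.snd = b.snd) : a = b :=
  WithLp.ofLp_injective 2 (Prod.ext h₁ h₂)

@[simp] theorem fst_mk (p q : ℍ[ℝ]) : (mk p q).fst = p := rfl
@[simp] theorem snd_mk (p q : ℍ[ℝ]) : (mk p q).snd = q := rfl
@[simp] theorem fst_mul (a b : Octonion) : (a * b).fst = a.fst * b.fst - star b.snd * a.snd := rfl
@[simp] theorem snd_mul (a b : Octonion) : (a * b).snd = b.snd * a.fst + a.snd * star b.fst := rfl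
@[simp] theorem fst_one : (1 : Octonion).fst = 1 := rfl
@[simp] theorem snd_one : (1 : Octonion).snd = 0 := rfl
@[simp] theorem fst_zero : (0 : Octonion).fst = 0 := rfl
@[simp] theorem snd_zero : (0 : Octonion).snd = 0 := rfl
@[simp] theorem fst_conj (a : Octonion) : a.conj.fst = star a.fst := rfl
@[simp] theorem snd_conj (a : Octonion) : a.conj.snd = -a.snd := rfl
@[simp] theorem fst_smul (r : ℝ) (a : Octonion) : (r • a).fst = r • a.fst := rfl
@[simp] theorem snd_smul (r : ℝ) (a : Octonion) : (r • a).snd = r • a.snd := rfl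
@[simp] theorem fst_add (a b : Octonion) : (a + b).fst = a.fst + b.fst := rfl
@[simp] theorem snd_add (a b : Octonion) : (a + b).snd = a.snd + b.snd := rfl

theorem norm_sq_eq (a : Octonion) : ‖a‖ ^ 2 =
    a.fst.re ^ 2 + a.fst.imI ^ 2 + a.fst.imJ ^ 2 + a.fst.imK ^ 2 +
    (a.snd.re ^ 2 + a.snd.imI ^ 2 + a.snd.imJ ^ 2 + a.snd.imK ^ 2) := by
  have h : ‖a‖ ^ 2 = ‖a.fst‖ ^ 2 + ‖a.snd‖ ^ 2 := WithLp.prod_norm_sq_eq_of_L2 a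
  rw [h, sq ‖a.fst‖, sq ‖a.snd‖, ← Quaternion.normSq_eq_norm_mul_self,
    ← Quaternion.normSq_eq_norm_mul_self, Quaternion.normSq_def', Quaternion.normSq_def']

/-- The norm agrees with `|a|² = Re (a ā)`. -/
theorem re_mul_conj_self (a : Octonion) : (a * a.conj).re = ‖a‖ ^ 2 := by
  rw [norm_sq_eq]; simp [re]; ring

theorem norm_sq_mul (a b : Octonion) : ‖a * b‖ ^ 2 = ‖a‖ ^ 2 * ‖b‖ ^ 2 := by
  simp only [norm_sq_eq]; simp; ring

theorem norm_mul' (a b : Octonion) : ‖a * b‖ = ‖a‖ * ‖b‖ := by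
  have h := norm_sq_mul a b
  rw [← mul_pow] at h
  exact (pow_left_inj₀ (norm_nonneg _) (by positivity) two_ne_zero).1 h

theorem mul_smul' (r : ℝ) (a b : Octonion) : a * (r • b) = r • (a * b) := by
  apply ext' <;> ext <;> simp <;> ring
theorem smul_mul' (r : ℝ) (a b : Octonion) : (r • a) * b = r • (a * b) := by
  apply ext' <;> ext <;> simp <;> ring

theorem one_mul' (a : Octonion) : 1 * a = a := by
  apply ext' <;> simp
theorem mul_one' (a : Octonion) : a * 1 = a := by
  apply ext' <;> simp
theorem zero_mul' (a : Octonion) : 0 * a = 0 := by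
  apply ext' <;> simp
theorem mul_zero' (a : Octonion) : a * 0 = 0 := by
  apply ext' <;> simp

theorem mul_mul_conj (a b : Octonion) : (a * b) * b.conj = ‖b‖ ^ 2 • a := by
  rw [norm_sq_eq]; apply ext' <;> ext <;> simp <;> ring
theorem mul_conj_mul (a b : Octonion) : (a * b.conj) * b = ‖b‖ ^ 2 • a := by
  rw [norm_sq_eq]; apply ext' <;> ext <;> simp <;> ring
theorem conj_mul_mul (a b : Octonion) : b.conj * (b * a) = ‖b‖ ^ 2 • a := by
  rw [norm_sq_eq]; apply ext' <;> ext <;> simp <;> ring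
theorem conj_mul (a b : Octonion) : (a * b).conj = b.conj * a.conj := by
  apply ext' <;> ext <;> simp
theorem conj_conj (a : Octonion) : a.conj.conj = a := by apply ext' <;> simp
theorem norm_conj (a : Octonion) : ‖a.conj‖ = ‖a‖ := by
  have h : ‖a.conj‖ ^ 2 = ‖a‖ ^ 2 := by simp [norm_sq_eq]
  exact (pow_left_inj₀ (norm_nonneg _) (norm_nonneg _) two_ne_zero).1 h

theorem norm_sq_ne {a : Octonion} (h : a ≠ 0) : ‖a‖ ^ 2 ≠ 0 := by simpa using h

theorem norm_one' : ‖(1 : Octonion)‖ = 1 := by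
  have h : ‖(1 : Octonion)‖ ^ 2 = 1 ^ 2 := by simp [norm_sq_eq]
  exact (pow_left_inj₀ (norm_nonneg _) zero_le_one two_ne_zero).1 h
theorem one_ne_zero' : (1 : Octonion) ≠ 0 := by
  rw [← norm_ne_zero_iff, norm_one']; exact one_ne_zero
theorem inv_zero' : (0 : Octonion)⁻¹ = 0 := by simp [inv_def]
theorem norm_inv' (a : Octonion) : ‖a⁻¹‖ = ‖a‖⁻¹ := by
  by_cases h : a = 0
  · subst h; simp [inv_zero']
  · have := norm_ne_zero_iff.2 h
    rw [inv_def, norm_smul, norm_conj]; simp; field_simp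
theorem inv_inv' (a : Octonion) : a⁻¹⁻¹ = a := by
  by_cases h : a = 0
  · subst h; simp [inv_zero']
  · have h0 := norm_ne_zero_iff.2 h
    rw [inv_def, norm_inv', inv_def]
    have : ((‖a‖ ^ 2)⁻¹ • a.conj).conj = (‖a‖ ^ 2)⁻¹ • a := by
      apply ext' <;> ext <;> simp
    rw [this, smul_smul]
    have : (‖a‖⁻¹ ^ 2)⁻¹ * (‖a‖ ^ 2)⁻¹ = 1 := by field_simp
    rw [this, one_smul]
theorem inv_one' : (1 : Octonion)⁻¹ = 1 := by
  rw [inv_def, norm_one']; apply ext' <;> simp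
theorem inv_ne_zero' {a : Octonion} (h : a ≠ 0) : a⁻¹ ≠ 0 := by
  rw [← norm_ne_zero_iff, norm_inv']; exact inv_ne_zero (norm_ne_zero_iff.2 h)
theorem mul_mul_inv (a : Octonion) {b : Octonion} (h : b ≠ 0) : (a * b) * b⁻¹ = a := by
  rw [inv_def, mul_smul', mul_mul_conj, smul_smul, inv_mul_cancel₀ (norm_sq_ne h), one_smul]
theorem mul_inv_mul (a : Octonion) {b : Octonion} (h : b ≠ 0) : (a * b⁻¹) * b = a := by
  rw [inv_def, mul_smul', smul_mul', mul_conj_mul, smul_smul, inv_mul_cancel₀ (norm_sq_ne h),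
    one_smul]
theorem inv_mul_mul (a : Octonion) {b : Octonion} (h : b ≠ 0) : b⁻¹ * (b * a) = a := by
  rw [inv_def, smul_mul', conj_mul_mul, smul_smul, inv_mul_cancel₀ (norm_sq_ne h), one_smul]
theorem mul_inv_self {b : Octonion} (h : b ≠ 0) : b * b⁻¹ = 1 := by
  simpa [one_mul'] using mul_mul_inv 1 h
theorem inv_mul_self {b : Octonion} (h : b ≠ 0) : b⁻¹ * b = 1 := by
  simpa [one_mul'] using mul_inv_mul 1 h
theorem mul_inv_rev' (a b : Octonion) : (a * b)⁻¹ = b⁻¹ * a⁻¹ := by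
  simp only [inv_def, norm_sq_mul, conj_mul, mul_smul', smul_mul', smul_smul, mul_inv]

theorem contDiff_fst {n : WithTop ℕ∞} : ContDiff ℝ n fst :=
  (LinearMap.toContinuousLinearMap
    ({ toFun := fst, map_add' := fun _ _ => rfl, map_smul' := fun _ _ => rfl } :
      Octonion →ₗ[ℝ] ℍ[ℝ])).contDiff
theorem contDiff_snd {n : WithTop ℕ∞} : ContDiff ℝ n snd :=
  (LinearMap.toContinuousLinearMap
    ({ toFun := snd, map_add' := fun _ _ => rfl, map_smul' := fun _ _ => rfl } :
      Octonion →ₗ[ℝ] ℍ[ℝ])).contDiff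
theorem contDiff_mk {n : WithTop ℕ∞} : ContDiff ℝ n fun p : ℍ[ℝ] × ℍ[ℝ] => mk p.1 p.2 :=
  (LinearMap.toContinuousLinearMap
    ({ toFun := fun p => mk p.1 p.2, map_add' := fun _ _ => rfl, map_smul' := fun _ _ => rfl } :
      ℍ[ℝ] × ℍ[ℝ] →ₗ[ℝ] Octonion)).contDiff
theorem contDiff_starQ {n : WithTop ℕ∞} : ContDiff ℝ n (star : ℍ[ℝ] → ℍ[ℝ]) :=
  (LinearMap.toContinuousLinearMap
    ({ toFun := star, map_add' := star_add, map_smul' := fun r q => Quaternion.star_smul r q } :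
      ℍ[ℝ] →ₗ[ℝ] ℍ[ℝ])).contDiff

theorem contDiff_mul' {n : WithTop ℕ∞} : ContDiff ℝ n fun p : Octonion × Octonion => p.1 * p.2 := by
  have h1 := contDiff_fst (n := n).comp (_root_.contDiff_fst (𝕜 := ℝ) (E := Octonion) (F := Octonion))
  have h2 := contDiff_snd (n := n).comp (_root_.contDiff_fst (𝕜 := ℝ) (E := Octonion) (F := Octonion))
  have h3 := contDiff_fst (n := n).comp (_root_.contDiff_snd (𝕜 := ℝ) (E := Octonion) (F := Octonion))
  have h4 := contDiff_snd (n := n).comp (_root_.contDiff_snd (𝕜 := ℝ) (E := Octonion) (F := Octonion))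
  exact contDiff_mk.comp (((h1.mul h3).sub ((contDiff_starQ.comp h4).mul h2)).prodMk
    ((h4.mul h1).add (h2.mul (contDiff_starQ.comp h3))))

theorem contDiff_conj {n : WithTop ℕ∞} : ContDiff ℝ n conj :=
  contDiff_mk.comp ((contDiff_starQ.comp contDiff_fst).prodMk contDiff_snd.neg)

theorem contDiffAt_inv' {n : WithTop ℕ∞} {a : Octonion} (h : a ≠ 0) :
    ContDiffAt ℝ n (fun x : Octonion => x⁻¹) a :=
  ((contDiff_norm_sq ℝ).contDiffAt.inv (norm_sq_ne h)).smul contDiff_conj.contDiffAt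

theorem continuous_mul' : Continuous fun p : Octonion × Octonion => p.1 * p.2 :=
  (contDiff_mul' (n := 0)).continuous
theorem continuousAt_inv' {a : Octonion} (h : a ≠ 0) :
    ContinuousAt (fun x : Octonion => x⁻¹) a :=
  (contDiffAt_inv' (n := 0) h).continuousAt

end Octonion

/-- The model space `𝕆²` of the charts. -/
abbrev OctPair : Type := Octonion × Octonion

namespace OP11
open Octonion

/-- `U₁ = {(1, u, v) : 1 + |u|² - |v|² > 0}`. -/
def U₁ : Set (Octonion × Octonion × Octonion) :=
  {x | x.1 = 1 ∧ 0 < 1 + ‖x.2.1‖ ^ 2 - ‖x.2.2‖ ^ 2}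
/-- `U₂ = {(u, 1, v) : |u|² + 1 - |v|² > 0}`. -/
def U₂ : Set (Octonion × Octonion × Octonion) :=
  {x | x.2.1 = 1 ∧ 0 < ‖x.1‖ ^ 2 + 1 - ‖x.2.2‖ ^ 2}
/-- The space of reduced homogeneous coordinates, a subspace of `𝕆³`. -/
abbrev Coords : Type := ↥(U₁ ∪ U₂)

/-- `[a,b,c] ∼ [d,e,f]` iff `a = dλ`, `b = eλ`, `c = fλ` for some `λ ≠ 0`. -/
def Rel (x y : Octonion × Octonion × Octonion) : Prop :=
  ∃ l : Octonion, l ≠ 0 ∧ x.1 = y.1 * l ∧ x.2.1 = y.2.1 * l ∧ x.2.2 = y.2.2 * l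

theorem rel_refl (x) : Rel x x := ⟨1, one_ne_zero', by simp [mul_one']⟩

theorem rel_symm {x y} (h : Rel x y) : Rel y x := by
  obtain ⟨l, hl, h1, h2, h3⟩ := h
  exact ⟨l⁻¹, inv_ne_zero' hl, by rw [h1, mul_mul_inv _ hl], by rw [h2, mul_mul_inv _ hl],
    by rw [h3, mul_mul_inv _ hl]⟩

/-- Two distinct equivalent elements are of the form `(1, u, v)` and `(u⁻¹, 1, v u⁻¹)`. -/
theorem rel_cases {x y : Octonion × Octonion × Octonion} (hx : x ∈ U₁ ∪ U₂) (hy : y ∈ U₁ ∪ U₂)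
    (h : Rel x y) : x = y ∨ ∃ u v : Octonion, u ≠ 0 ∧
      ((x = (1, u, v) ∧ y = (u⁻¹, 1, v * u⁻¹)) ∨ (y = (1, u, v) ∧ x = (u⁻¹, 1, v * u⁻¹))) := by
  obtain ⟨a, b, c⟩ := x
  obtain ⟨d, e, f⟩ := y
  obtain ⟨l, hl, h1, h2, h3⟩ := h
  simp only at h1 h2 h3
  rcases hx with ⟨hx, -⟩ | ⟨hx, -⟩ <;> rcases hy with ⟨hy, -⟩ | ⟨hy, -⟩ <;>
    simp only at hx hy <;> subst hx hy
  · have : l = 1 := by rw [h1, one_mul']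
    subst this; left; simp [h2, h3, mul_one']
  · right
    refine ⟨l, c, hl, Or.inl ⟨by rw [h2, one_mul'], ?_⟩⟩
    have e1 : d = l⁻¹ := by rw [← mul_mul_inv d hl, ← h1, one_mul']
    rw [h3, mul_mul_inv _ hl, e1]
  · right
    have e1 : e = l⁻¹ := by rw [← mul_mul_inv e hl, ← h2, one_mul']
    refine ⟨l⁻¹, f, inv_ne_zero' hl, Or.inr ⟨by rw [e1], ?_⟩⟩
    rw [inv_inv', h3, h1, one_mul']
  · have : l = 1 := by rw [h2, one_mul']
    subst this; left; simp [h1, h3, mul_one']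

theorem rel_trans {x y z : Octonion × Octonion × Octonion} (hx : x ∈ U₁ ∪ U₂) (hy : y ∈ U₁ ∪ U₂)
    (hz : z ∈ U₁ ∪ U₂) (h : Rel x y) (h' : Rel y z) : Rel x z := by
  rcases rel_cases hx hy h with rfl | ⟨u, v, hu, ⟨e1, e2⟩ | ⟨e1, e2⟩⟩
  · exact h'
  · rcases rel_cases hy hz h' with rfl | ⟨u', v', hu', ⟨e3, e4⟩ | ⟨e3, e4⟩⟩
    · exact h
    · have hu1 : u = 1 := by
        have : u⁻¹ = 1 := by simpa using congrArg Prod.fst (e2.symm.trans e3)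
        rw [← inv_inv' u, this, inv_one']
      have : x = y := by rw [e1, e2, hu1, inv_one', mul_one']
      rwa [this]
    · have e5 := e2.symm.trans e4
      simp only [Prod.mk.injEq, true_and] at e5
      have hu1 : u = u' := by rw [← inv_inv' u, e5.1, inv_inv']
      subst hu1
      have : v = v' := by rw [← mul_inv_mul v hu, e5.2, mul_inv_mul v' hu]
      subst this
      rw [e1, e3]; exact rel_refl _
  · rcases rel_cases hy hz h' with rfl | ⟨u', v', hu', ⟨e3, e4⟩ | ⟨e3, e4⟩⟩
    · exact h
    · have e5 := e1.symm.trans e3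
      simp only [Prod.mk.injEq, true_and] at e5
      rw [e2, e4, e5.1, e5.2]; exact rel_refl _
    · have hu1 : u = 1 := by
        simpa using congrArg (fun p => p.2.1) (e1.symm.trans e4)
      have : x = y := by rw [e1, e2, hu1, inv_one', mul_one']
      rwa [this]

/-- The relation `∼` on `U₁ ∪ U₂` is an equivalence relation. -/
instance relSetoid : Setoid Coords where
  r x y := Rel x.1 y.1
  iseqv := ⟨fun x => rel_refl x.1, fun h => rel_symm h,
    fun {x y z} h h' => rel_trans x.2 y.2 z.2 h h'⟩

end OP11

/-- The indefinite octonionic projective plane, with the quotient topology. -/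
def OP11 : Type := Quotient OP11.relSetoid

namespace OP11
open Octonion

instance : TopologicalSpace OP11 := inferInstanceAs (TopologicalSpace (Quotient relSetoid))

/-- The class `[a, b, c]`. -/
def cls (x : Coords) : OP11 := Quotient.mk relSetoid x

theorem isQuotientMap_cls : Topology.IsQuotientMap cls := isQuotientMap_quotient_mk'

theorem ind {P : OP11 → Prop} (h : ∀ x, P (cls x)) (p) : P p := Quotient.ind h p

theorem cls_eq {x y : Coords} : cls x = cls y ↔ Rel x.1 y.1 := Quotient.eq

/-- `U₁/∼`, the set of classes of elements of `U₁`. -/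
def D₁ : Set OP11 := cls '' {x | x.1 ∈ U₁}
/-- `U₂/∼`, the set of classes of elements of `U₂`. -/
def D₂ : Set OP11 := cls '' {x | x.1 ∈ U₂}
/-- `U₃/∼`, the set of classes `[a, b, c]` with `c ≠ 0`. -/
def D₃ : Set OP11 := cls '' {x | x.1.2.2 ≠ 0}

theorem lift_aux {f : Octonion × Octonion × Octonion → OctPair}
    (hf : ∀ u v : Octonion, u ≠ 0 → f (1, u, v) = f (u⁻¹, 1, v * u⁻¹)) (x y : Coords)
    (h : Rel x.1 y.1) : f x.1 = f y.1 := by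
  rcases rel_cases x.2 y.2 h with e | ⟨u, v, hu, ⟨e1, e2⟩ | ⟨e1, e2⟩⟩
  · rw [e]
  · rw [e1, e2, hf u v hu]
  · rw [e1, e2, hf u v hu]

/-- The coordinates on `U₁/∼`: `[1, u, v] ↦ (u, v)`; in general `[a, b, c] ↦ (b a⁻¹, c a⁻¹)`. -/
def φ₁ (p : OP11) : OctPair :=
  Quotient.lift (fun x : Coords => ((x.1.2.1 * x.1.1⁻¹, x.1.2.2 * x.1.1⁻¹) : OctPair))
    (lift_aux (f := fun x => (x.2.1 * x.1⁻¹, x.2.2 * x.1⁻¹)) (fun u v hu => by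
      simp [inv_one', mul_one', one_mul', inv_inv', mul_inv_mul _ hu])) p

/-- The coordinates on `U₂/∼`: `[u, 1, v] ↦ (u, v)`; in general `[a, b, c] ↦ (a b⁻¹, c b⁻¹)`. -/
def φ₂ (p : OP11) : OctPair :=
  Quotient.lift (fun x : Coords => ((x.1.1 * x.1.2.1⁻¹, x.1.2.2 * x.1.2.1⁻¹) : OctPair))
    (lift_aux (f := fun x => (x.1 * x.2.1⁻¹, x.2.2 * x.2.1⁻¹)) (fun u v hu => by
      simp [inv_one', mul_one', one_mul'])) p

/-- The coordinates on `U₃/∼`: `[x, y, 1] ↦ (x, y)`; in general `[a, b, c] ↦ (a c⁻¹, b c⁻¹)`. -/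
def φ₃ (p : OP11) : OctPair :=
  Quotient.lift (fun x : Coords => ((x.1.1 * x.1.2.2⁻¹, x.1.2.1 * x.1.2.2⁻¹) : OctPair))
    (lift_aux (f := fun x => (x.1 * x.2.2⁻¹, x.2.1 * x.2.2⁻¹)) (fun u v hu => by
      simp [one_mul', mul_inv_rev', inv_inv', inv_mul_mul _ hu])) p

theorem φ₁_cls (x : Coords) : φ₁ (cls x) = (x.1.2.1 * x.1.1⁻¹, x.1.2.2 * x.1.1⁻¹) := rfl
theorem φ₂_cls (x : Coords) : φ₂ (cls x) = (x.1.1 * x.1.2.1⁻¹, x.1.2.2 * x.1.2.1⁻¹) := rfl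
theorem φ₃_cls (x : Coords) : φ₃ (cls x) = (x.1.1 * x.1.2.2⁻¹, x.1.2.1 * x.1.2.2⁻¹) := rfl

/-- The common coordinate domain `{(u, v) : 1 + |u|² - |v|² > 0}` of `U₁/∼` and `U₂/∼`. -/
def target : Set OctPair := {w | 0 < 1 + ‖w.1‖ ^ 2 - ‖w.2‖ ^ 2}

theorem isOpen_target : IsOpen target :=
  isOpen_lt continuous_const (by fun_prop)

/-- The point `[1, u, v]`. -/
def pt₁ (w : target) : OP11 := cls ⟨(1, w.1.1, w.1.2), Or.inl ⟨rfl, w.2⟩⟩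
/-- The point `[u, 1, v]`. -/
def pt₂ (w : target) : OP11 := cls ⟨(w.1.1, 1, w.1.2), Or.inr ⟨rfl, by
  have := w.2; simp only [target, Set.mem_ofPred_eq] at this; dsimp only; linarith⟩⟩

theorem zero_mem_target : (0 : OctPair) ∈ target := by simp [target]

open Classical in
/-- Inverse of `φ₁`, with an irrelevant value outside `target`. -/
def ψ₁ (w : OctPair) : OP11 := if h : w ∈ target then pt₁ ⟨w, h⟩ else pt₁ ⟨0, zero_mem_target⟩
open Classical in
/-- Inverse of `φ₂`, with an irrelevant value outside `target`. -/
def ψ₂ (w : OctPair) : OP11 := if h : w ∈ target then pt₂ ⟨w, h⟩ else pt₂ ⟨0, zero_mem_target⟩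

theorem φ₁_pt₁ (w : target) : φ₁ (pt₁ w) = w.1 := by
  rw [pt₁, φ₁_cls]; simp [inv_one', mul_one']
theorem φ₂_pt₂ (w : target) : φ₂ (pt₂ w) = w.1 := by
  rw [pt₂, φ₂_cls]; simp [inv_one', mul_one']

theorem mem_D₁ {p : OP11} : p ∈ D₁ ↔ ∃ w, p = pt₁ w := by
  constructor
  · rintro ⟨⟨⟨a, b, c⟩, hx⟩, ⟨h, h'⟩, rfl⟩
    simp only at h h'; subst h
    exact ⟨⟨(b, c), h'⟩, rfl⟩
  · rintro ⟨w, rfl⟩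
    exact ⟨⟨(1, w.1.1, w.1.2), Or.inl ⟨rfl, w.2⟩⟩, ⟨rfl, w.2⟩, rfl⟩

theorem mem_D₂ {p : OP11} : p ∈ D₂ ↔ ∃ w, p = pt₂ w := by
  constructor
  · rintro ⟨⟨⟨a, b, c⟩, hx⟩, ⟨h, h'⟩, rfl⟩
    simp only at h h'; subst h
    exact ⟨⟨(a, c), by simp only [target, Set.mem_ofPred_eq]; linarith⟩, rfl⟩
  · rintro ⟨w, rfl⟩
    refine ⟨_, ⟨rfl, ?_⟩, rfl⟩
    have := w.2; simp only [target, Set.mem_ofPred_eq] at this; dsimp only; linarith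

theorem trans_mem {u v : Octonion} (hu : u ≠ 0) (h : (u, v) ∈ target) :
    (u⁻¹, v * u⁻¹) ∈ target := by
  simp only [target, Set.mem_ofPred_eq, norm_mul', norm_inv'] at h ⊢
  have h0 := norm_pos_iff.2 hu
  have : 1 + ‖u‖⁻¹ ^ 2 - (‖v‖ * ‖u‖⁻¹) ^ 2 = (1 + ‖u‖ ^ 2 - ‖v‖ ^ 2) / ‖u‖ ^ 2 := by
    field_simp; ring
  rw [this]; positivity

theorem pt₁_eq_pt₂ {u v : Octonion} (hu : u ≠ 0) (h : (u, v) ∈ target) :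
    pt₁ ⟨(u, v), h⟩ = pt₂ ⟨(u⁻¹, v * u⁻¹), trans_mem hu h⟩ :=
  cls_eq.2 ⟨u, hu, by simp [inv_mul_self hu], by simp [one_mul'], by simp [mul_inv_mul _ hu]⟩

theorem pt₂_eq_pt₁ {u v : Octonion} (hu : u ≠ 0) (h : (u, v) ∈ target) :
    pt₂ ⟨(u, v), h⟩ = pt₁ ⟨(u⁻¹, v * u⁻¹), trans_mem hu h⟩ :=
  cls_eq.2 ⟨u, hu, by simp [one_mul'], by simp [inv_mul_self hu], by simp [mul_inv_mul _ hu]⟩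

theorem cls_mem_D₁ {x : Coords} : cls x ∈ D₁ ↔ x.1.1 ≠ 0 := by
  obtain ⟨⟨a, b, c⟩, hx⟩ := x
  constructor
  · rintro ⟨y, ⟨hy, -⟩, h⟩ h0
    obtain ⟨l, hl, h1, -⟩ := cls_eq.1 h
    rw [hy, h0, zero_mul'] at h1
    exact one_ne_zero' h1
  · intro h
    rcases hx with hx | ⟨hx, hx'⟩
    · exact ⟨_, hx, rfl⟩
    · simp only at hx hx' h; subst hx
      have ht : (a, c) ∈ target := by simp only [target, Set.mem_ofPred_eq]; linarith
      exact mem_D₁.2 ⟨_, pt₂_eq_pt₁ h ht⟩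

theorem cls_mem_D₂ {x : Coords} : cls x ∈ D₂ ↔ x.1.2.1 ≠ 0 := by
  obtain ⟨⟨a, b, c⟩, hx⟩ := x
  constructor
  · rintro ⟨y, ⟨hy, -⟩, h⟩ h0
    obtain ⟨l, hl, -, h1, -⟩ := cls_eq.1 h
    rw [hy, h0, zero_mul'] at h1
    exact one_ne_zero' h1
  · intro h
    rcases hx with ⟨hx, hx'⟩ | hx
    · simp only at hx hx' h; subst hx
      exact mem_D₂.2 ⟨_, pt₁_eq_pt₂ h hx'⟩
    · exact ⟨_, hx, rfl⟩

theorem isOpen_D₁ : IsOpen D₁ := by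
  rw [← isQuotientMap_cls.isOpen_preimage]
  have : cls ⁻¹' D₁ = {x | x.1.1 ≠ 0} := by ext x; exact cls_mem_D₁
  rw [this]
  exact isOpen_ne_fun (by fun_prop) continuous_const

theorem isOpen_D₂ : IsOpen D₂ := by
  rw [← isQuotientMap_cls.isOpen_preimage]
  have : cls ⁻¹' D₂ = {x | x.1.2.1 ≠ 0} := by ext x; exact cls_mem_D₂
  rw [this]
  exact isOpen_ne_fun (by fun_prop) continuous_const

theorem continuousOn_lift {s : Set OP11} (hs : IsOpen s) {f : OP11 → OctPair}
    (h : ∀ x : Coords, cls x ∈ s → ContinuousAt (fun x => f (cls x)) x) : ContinuousOn f s := by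
  rw [isQuotientMap_cls.continuousOn_isOpen_iff hs]
  intro x hx
  exact (h x hx).continuousWithinAt

theorem continuousAt_quot {x : Coords} {f g : Coords → Octonion} (hf : Continuous f)
    (hg : Continuous g) (h : g x ≠ 0) : ContinuousAt (fun x => f x * (g x)⁻¹) x := by
  have h1 : ContinuousAt (fun x => (g x)⁻¹) x := (continuousAt_inv' h).comp hg.continuousAt
  have h2 : ContinuousAt (fun x => (f x, (g x)⁻¹)) x := hf.continuousAt.prodMk h1
  have h3 := ContinuousAt.comp' continuous_mul'.continuousAt h2
  exact h3

theorem continuousOn_φ₁ : ContinuousOn φ₁ D₁ := by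
  refine continuousOn_lift isOpen_D₁ fun x hx => ?_
  have h := cls_mem_D₁.1 hx
  exact (continuousAt_quot (by fun_prop) (by fun_prop) h).prodMk
    (continuousAt_quot (by fun_prop) (by fun_prop) h)

theorem continuousOn_φ₂ : ContinuousOn φ₂ D₂ := by
  refine continuousOn_lift isOpen_D₂ fun x hx => ?_
  have h := cls_mem_D₂.1 hx
  exact (continuousAt_quot (by fun_prop) (by fun_prop) h).prodMk
    (continuousAt_quot (by fun_prop) (by fun_prop) h)

theorem continuous_pt₁ : Continuous pt₁ :=
  isQuotientMap_cls.continuous.comp (Continuous.subtype_mk (by fun_prop) _)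
theorem continuous_pt₂ : Continuous pt₂ :=
  isQuotientMap_cls.continuous.comp (Continuous.subtype_mk (by fun_prop) _)

theorem ψ₁_of_mem {w : OctPair} (h : w ∈ target) : ψ₁ w = pt₁ ⟨w, h⟩ := dif_pos h
theorem ψ₂_of_mem {w : OctPair} (h : w ∈ target) : ψ₂ w = pt₂ ⟨w, h⟩ := dif_pos h

/-- The chart `[1, u, v] ↦ (u, v)` on `U₁/∼`. -/
def chart₁ : OpenPartialHomeomorph OP11 OctPair where
  toFun := φ₁
  invFun := ψ₁
  source := D₁
  target := target
  map_source' p hp := by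
    obtain ⟨w, rfl⟩ := mem_D₁.1 hp
    rw [φ₁_pt₁]; exact w.2
  map_target' w hw := mem_D₁.2 ⟨_, ψ₁_of_mem hw⟩
  left_inv' p hp := by
    obtain ⟨w, rfl⟩ := mem_D₁.1 hp
    rw [φ₁_pt₁, ψ₁_of_mem w.2]
  right_inv' w hw := by rw [ψ₁_of_mem hw, φ₁_pt₁]
  open_source := isOpen_D₁
  open_target := isOpen_target
  continuousOn_toFun := continuousOn_φ₁
  continuousOn_invFun := by
    rw [continuousOn_iff_continuous_domRestrict]
    exact continuous_pt₁.congr fun w => (ψ₁_of_mem w.2).symm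

/-- The chart `[u, 1, v] ↦ (u, v)` on `U₂/∼`. -/
def chart₂ : OpenPartialHomeomorph OP11 OctPair where
  toFun := φ₂
  invFun := ψ₂
  source := D₂
  target := target
  map_source' p hp := by
    obtain ⟨w, rfl⟩ := mem_D₂.1 hp
    rw [φ₂_pt₂]; exact w.2
  map_target' w hw := mem_D₂.2 ⟨_, ψ₂_of_mem hw⟩
  left_inv' p hp := by
    obtain ⟨w, rfl⟩ := mem_D₂.1 hp
    rw [φ₂_pt₂, ψ₂_of_mem w.2]
  right_inv' w hw := by rw [ψ₂_of_mem hw, φ₂_pt₂]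
  open_source := isOpen_D₂
  open_target := isOpen_target
  continuousOn_toFun := continuousOn_φ₂
  continuousOn_invFun := by
    rw [continuousOn_iff_continuous_domRestrict]
    exact continuous_pt₂.congr fun w => (ψ₂_of_mem w.2).symm

theorem mem_D₁_or_D₂ (p : OP11) : p ∈ D₁ ∨ p ∈ D₂ := by
  induction p using ind with
  | h x => exact x.2.imp (fun h => ⟨x, h, rfl⟩) (fun h => ⟨x, h, rfl⟩)

open Classical in
instance : ChartedSpace OctPair OP11 where
  atlas := {chart₁, chart₂}
  chartAt p := if p ∈ D₁ then chart₁ else chart₂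
  mem_chart_source p := by
    split_ifs with h
    · exact h
    · exact (mem_D₁_or_D₂ p).resolve_left h
  chart_mem_atlas p := by split_ifs <;> simp

theorem contDiffAt_trans {n : WithTop ℕ∞} {w : OctPair} (h : w.1 ≠ 0) :
    ContDiffAt ℝ n (fun w : OctPair => (w.1⁻¹, w.2 * w.1⁻¹)) w := by
  have h1 : ContDiffAt ℝ n (fun w : OctPair => w.1⁻¹) w := (contDiffAt_inv' h).comp w contDiffAt_fst
  have h2 : ContDiffAt ℝ n (fun w : OctPair => (w.2, w.1⁻¹)) w := contDiffAt_snd.prodMk h1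
  have h3 := contDiff_mul'.contDiffAt.comp w h2
  exact h1.prodMk h3

theorem contDiffOn_trans₁₂ {n : WithTop ℕ∞} :
    ContDiffOn ℝ n (chart₁.symm.trans chart₂) (chart₁.symm.trans chart₂).source := by
  rintro ⟨u, v⟩ ⟨hw, hw'⟩
  have hu : u ≠ 0 := by
    have h1 : ψ₁ (u, v) ∈ D₂ := hw'
    rw [ψ₁_of_mem hw] at h1
    exact cls_mem_D₂.1 h1
  refine (contDiffAt_trans hu).contDiffWithinAt.congr_of_mem ?_ ⟨hw, hw'⟩
  rintro w ⟨hw, hw'⟩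
  change φ₂ (ψ₁ w) = _
  rw [ψ₁_of_mem hw, pt₁, φ₂_cls]
  simp [one_mul']

theorem contDiffOn_trans₂₁ {n : WithTop ℕ∞} :
    ContDiffOn ℝ n (chart₂.symm.trans chart₁) (chart₂.symm.trans chart₁).source := by
  rintro ⟨u, v⟩ ⟨hw, hw'⟩
  have hu : u ≠ 0 := by
    have h1 : ψ₂ (u, v) ∈ D₁ := hw'
    rw [ψ₂_of_mem hw] at h1
    exact cls_mem_D₁.1 h1
  refine (contDiffAt_trans hu).contDiffWithinAt.congr_of_mem ?_ ⟨hw, hw'⟩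
  rintro w ⟨hw, hw'⟩
  change φ₁ (ψ₂ w) = _
  rw [ψ₂_of_mem hw, pt₂, φ₁_cls]
  simp [one_mul']

/-- The transition maps are smooth (even analytic). -/
instance {n : WithTop ℕ∞} : IsManifold 𝓘(ℝ, OctPair) n OP11 := by
  apply isManifold_of_contDiffOn
  have aux : ∀ e : OpenPartialHomeomorph OP11 OctPair,
      ContDiffOn ℝ n (e.symm.trans e) (e.symm.trans e).source := fun e =>
    contDiffOn_id.congr fun w hw => e.right_inv hw.1
  rintro e e' (rfl | rfl) (rfl | rfl)
  · simpa using aux chart₁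
  · simpa using contDiffOn_trans₁₂
  · simpa using contDiffOn_trans₂₁
  · simpa using aux chart₂

end OP11

namespace OP11
open Octonion

theorem isOpen_lt_norm : IsOpen (cls '' {x | ‖x.1.2.1‖ < ‖x.1.1‖}) ∧
    IsOpen (cls '' {x | ‖x.1.1‖ < ‖x.1.2.1‖}) := by
  constructor
  · rw [← isQuotientMap_cls.isOpen_preimage]
    have : cls ⁻¹' (cls '' {x | ‖x.1.2.1‖ < ‖x.1.1‖}) = {x | ‖x.1.2.1‖ < ‖x.1.1‖} := by
      ext x
      constructor
      · rintro ⟨y, hy, h⟩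
        obtain ⟨l, hl, h1, h2, -⟩ := cls_eq.1 h
        simp only [Set.mem_ofPred_eq, h1, h2, norm_mul'] at hy ⊢
        exact lt_of_mul_lt_mul_right hy (norm_nonneg l)
      · exact fun h => ⟨x, h, rfl⟩
    rw [this]
    exact isOpen_lt (by fun_prop) (by fun_prop)
  · rw [← isQuotientMap_cls.isOpen_preimage]
    have : cls ⁻¹' (cls '' {x | ‖x.1.1‖ < ‖x.1.2.1‖}) = {x | ‖x.1.1‖ < ‖x.1.2.1‖} := by
      ext x
      constructor
      · rintro ⟨y, hy, h⟩
        obtain ⟨l, hl, h1, h2, -⟩ := cls_eq.1 h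
        simp only [Set.mem_ofPred_eq, h1, h2, norm_mul'] at hy ⊢
        exact lt_of_mul_lt_mul_right hy (norm_nonneg l)
      · exact fun h => ⟨x, h, rfl⟩
    rw [this]
    exact isOpen_lt (by fun_prop) (by fun_prop)

theorem disjoint_lt_norm : Disjoint (cls '' {x | ‖x.1.2.1‖ < ‖x.1.1‖})
    (cls '' {x | ‖x.1.1‖ < ‖x.1.2.1‖}) := by
  rw [Set.disjoint_left]
  rintro _ ⟨x, hx, rfl⟩ ⟨y, hy, h⟩
  obtain ⟨l, hl, h1, h2, -⟩ := cls_eq.1 h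
  simp only [Set.mem_ofPred_eq, h1, h2, norm_mul'] at hx hy
  exact absurd (lt_of_mul_lt_mul_right hy (norm_nonneg l)) hx.le.not_gt

theorem not_mem_D₂ {p : OP11} (h : p ∉ D₂) : p ∈ cls '' {x | ‖x.1.2.1‖ < ‖x.1.1‖} := by
  obtain ⟨w, rfl⟩ := mem_D₁.1 ((mem_D₁_or_D₂ p).resolve_right h)
  have h0 := not_not.1 (mt cls_mem_D₂.2 h)
  exact ⟨_, by
    dsimp only at h0
    simp [h0, norm_one'], rfl⟩

theorem not_mem_D₁ {p : OP11} (h : p ∉ D₁) : p ∈ cls '' {x | ‖x.1.1‖ < ‖x.1.2.1‖} := by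
  obtain ⟨w, rfl⟩ := mem_D₂.1 ((mem_D₁_or_D₂ p).resolve_left h)
  have h0 := not_not.1 (mt cls_mem_D₁.2 h)
  exact ⟨_, by
    dsimp only at h0
    simp [h0, norm_one'], rfl⟩

theorem separate (e : OpenPartialHomeomorph OP11 OctPair) {p q : OP11} (hp : p ∈ e.source)
    (hq : q ∈ e.source) (h : p ≠ q) :
    ∃ u v : Set OP11, IsOpen u ∧ IsOpen v ∧ p ∈ u ∧ q ∈ v ∧ Disjoint u v := by
  obtain ⟨u, v, hu, hv, hpu, hqv, huv⟩ := t2_separation (e.injOn.ne hp hq h)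
  refine ⟨_, _, e.isOpen_inter_preimage hu, e.isOpen_inter_preimage hv, ⟨hp, hpu⟩, ⟨hq, hqv⟩, ?_⟩
  rw [Set.disjoint_left] at huv ⊢
  exact fun x hx hx' => huv hx.2 hx'.2

instance : T2Space OP11 := ⟨fun p q h => by
  by_cases hp : p ∈ D₁
  · by_cases hq : q ∈ D₁
    · exact separate chart₁ hp hq h
    · by_cases hp' : p ∈ D₂
      · exact separate chart₂ hp' ((mem_D₁_or_D₂ q).resolve_left hq) h
      · exact ⟨_, _, isOpen_lt_norm.1, isOpen_lt_norm.2, not_mem_D₂ hp', not_mem_D₁ hq,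
          disjoint_lt_norm⟩
  · by_cases hq : q ∈ D₂
    · exact separate chart₂ ((mem_D₁_or_D₂ p).resolve_left hp) hq h
    · exact ⟨_, _, isOpen_lt_norm.2, isOpen_lt_norm.1, not_mem_D₁ hp, not_mem_D₂ hq,
        disjoint_lt_norm.symm⟩⟩

instance : SecondCountableTopology OP11 := by
  refine ChartedSpace.secondCountable_of_countable_cover OctPair
    (s := {pt₁ ⟨0, zero_mem_target⟩, pt₂ ⟨0, zero_mem_target⟩}) ?_ (Set.toFinite _).countable
  have h1 : pt₁ ⟨0, zero_mem_target⟩ ∈ D₁ := mem_D₁.2 ⟨_, rfl⟩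
  have h2 : pt₂ ⟨0, zero_mem_target⟩ ∉ D₁ := fun h => cls_mem_D₁.1 h rfl
  have e1 : chartAt OctPair (pt₁ ⟨0, zero_mem_target⟩) = chart₁ := if_pos h1
  have e2 : chartAt OctPair (pt₂ ⟨0, zero_mem_target⟩) = chart₂ := if_neg h2
  rw [Set.biUnion_pair, e1, e2]
  exact Set.eq_univ_of_forall mem_D₁_or_D₂

end OP11

/-- A smooth semi-Riemannian (pseudo-Riemannian) metric: a smooth field of symmetric
nondegenerate bilinear forms on the tangent spaces. -/
structure SemiRiemannianMetric (E : Type*) [NormedAddCommGroup E] [NormedSpace ℝ E]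
    (M : Type*) [TopologicalSpace M] [ChartedSpace E M] [IsManifold 𝓘(ℝ, E) ∞ M] where
  val (p : M) : TangentSpace 𝓘(ℝ, E) p →L[ℝ] TangentSpace 𝓘(ℝ, E) p →L[ℝ] ℝ
  symm (p : M) (X Y : TangentSpace 𝓘(ℝ, E) p) : val p X Y = val p Y X
  nondegenerate (p : M) (X : TangentSpace 𝓘(ℝ, E) p) (h : ∀ Y, val p X Y = 0) : X = 0
  contMDiff : ContMDiff 𝓘(ℝ, E) (𝓘(ℝ, E).prod 𝓘(ℝ, E →L[ℝ] E →L[ℝ] ℝ)) ∞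
    (fun p : M => Bundle.TotalSpace.mk' (E →L[ℝ] E →L[ℝ] ℝ) p (val p))

namespace SemiRiemannianMetric

variable {E : Type*} [NormedAddCommGroup E] [NormedSpace ℝ E]
    {M : Type*} [TopologicalSpace M] [ChartedSpace E M] [IsManifold 𝓘(ℝ, E) ∞ M]

/-- The quadratic form `X ↦ g(X, X)` on the tangent space at `p`. -/
def quadraticForm (g : SemiRiemannianMetric E M) (p : M) :
    QuadraticForm ℝ (TangentSpace 𝓘(ℝ, E) p) :=
  LinearMap.BilinMap.toQuadraticMap
    (LinearMap.mk₂ ℝ (fun X Y => g.val p X Y) (by simp) (by simp) (by simp) (by simp))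

/-- The metric has signature `(k, l)` at every point. -/
def HasSignature (g : SemiRiemannianMetric E M) (k l : ℕ) : Prop :=
  ∀ p, _root_.sigPos (g.quadraticForm p) = k ∧ _root_.sigNeg (g.quadraticForm p) = l

/-- An isometry is a smooth bijection with smooth inverse whose differential preserves the
metric. -/
def IsIsometry (g : SemiRiemannianMetric E M) (F : Equiv.Perm M) : Prop :=
  ContMDiff 𝓘(ℝ, E) 𝓘(ℝ, E) ∞ F ∧ ContMDiff 𝓘(ℝ, E) 𝓘(ℝ, E) ∞ F.symm ∧
    ∀ (p : M) (X Y : TangentSpace 𝓘(ℝ, E) p),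
      g.val (F p) (mfderiv 𝓘(ℝ, E) 𝓘(ℝ, E) F p X) (mfderiv 𝓘(ℝ, E) 𝓘(ℝ, E) F p Y) = g.val p X Y

theorem IsIsometry.one (g : SemiRiemannianMetric E M) : g.IsIsometry 1 := by
  refine ⟨contMDiff_id, contMDiff_id, fun p X Y => ?_⟩
  change g.val p (mfderiv _ _ id p X) (mfderiv _ _ id p Y) = _
  rw [mfderiv_id]; rfl

theorem IsIsometry.mul {g : SemiRiemannianMetric E M} {F G : Equiv.Perm M} (hF : g.IsIsometry F)
    (hG : g.IsIsometry G) : g.IsIsometry (F * G) := by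
  refine ⟨hF.1.comp hG.1, hG.2.1.comp hF.2.1, fun p X Y => ?_⟩
  have h : mfderiv 𝓘(ℝ, E) 𝓘(ℝ, E) (F ∘ G) p = (mfderiv 𝓘(ℝ, E) 𝓘(ℝ, E) F (G p)).comp
      (mfderiv 𝓘(ℝ, E) 𝓘(ℝ, E) G p) :=
    mfderiv_comp p (hF.1.mdifferentiable (by simp) _) (hG.1.mdifferentiable (by simp) _)
  change g.val (F (G p)) (mfderiv 𝓘(ℝ, E) 𝓘(ℝ, E) (F ∘ G) p X)
    (mfderiv 𝓘(ℝ, E) 𝓘(ℝ, E) (F ∘ G) p Y) = _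
  rw [h]
  exact (hF.2.2 (G p) _ _).trans (hG.2.2 p X Y)

theorem IsIsometry.inv {g : SemiRiemannianMetric E M} {F : Equiv.Perm M} (hF : g.IsIsometry F) :
    g.IsIsometry F⁻¹ := by
  refine ⟨hF.2.1, hF.1, fun p X Y => ?_⟩
  have h := mfderiv_comp p (hF.1.mdifferentiable (by simp) (F.symm p))
    (hF.2.1.mdifferentiable (by simp) p)
  have hid : (F ∘ F.symm : M → M) = id := funext F.apply_symm_apply
  rw [hid, mfderiv_id] at h
  have aux : ∀ (q : M) (hq : q = p) (X' Y' : E), X' = X → Y' = Y →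
      g.val q X' Y' = g.val p X Y := by
    rintro q rfl _ _ rfl rfl; rfl
  change g.val (F.symm p) (mfderiv 𝓘(ℝ, E) 𝓘(ℝ, E) F.symm p X)
    (mfderiv 𝓘(ℝ, E) 𝓘(ℝ, E) F.symm p Y) = _
  rw [← hF.2.2]
  refine aux _ (F.apply_symm_apply p) _ _ ?_ ?_
  · exact (DFunLike.congr_fun h X).symm
  · exact (DFunLike.congr_fun h Y).symm

/-- The isometry group. -/
def isometryGroup (g : SemiRiemannianMetric E M) : Subgroup (Equiv.Perm M) where
  carrier := {F | g.IsIsometry F}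
  mul_mem' hF hG := hF.mul hG
  one_mem' := IsIsometry.one g
  inv_mem' hF := hF.inv

end SemiRiemannianMetric

namespace OP11
open Octonion

/-- The expression
`ds² = (|du|² (1 - |v|²) - |dv|² (1 + |u|²) + 2 Re[(u v̄)(dv dū)]) / (1 + |u|² - |v|²)²`
at `w = (u, v)`, evaluated on the tangent vector `ξ = (du, dv)`. -/
def dsSq (w ξ : OctPair) : ℝ :=
  (‖ξ.1‖ ^ 2 * (1 - ‖w.2‖ ^ 2) - ‖ξ.2‖ ^ 2 * (1 + ‖w.1‖ ^ 2)
      + 2 * re ((w.1 * conj w.2) * (ξ.2 * conj ξ.1))) / (1 + ‖w.1‖ ^ 2 - ‖w.2‖ ^ 2) ^ 2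

/-- `g` is given by the expression `dsSq` in both charts `U₁/∼` and `U₂/∼`. -/
def IsGivenByDsSq (g : SemiRiemannianMetric OctPair OP11) : Prop :=
  (∀ p ∈ D₁, ∀ X : TangentSpace 𝓘(ℝ, OctPair) p,
    g.val p X X = dsSq (φ₁ p) (mfderiv 𝓘(ℝ, OctPair) 𝓘(ℝ, OctPair) φ₁ p X)) ∧
  (∀ p ∈ D₂, ∀ X : TangentSpace 𝓘(ℝ, OctPair) p,
    g.val p X X = dsSq (φ₂ p) (mfderiv 𝓘(ℝ, OctPair) 𝓘(ℝ, OctPair) φ₂ p X))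

/-- The "indefinite reflection" `(u, v) ↦ (-ru + λv, -λ̄u + rv)`, used for `r² - |λ|² = 1`. -/
def indefRefl (r : ℝ) (l : Octonion) (w : OctPair) : OctPair :=
  (-(r • w.1) + l * w.2, -(conj l * w.1) + r • w.2)

/-- The "Euclidean reflection" `(x, y) ↦ (rx + λy, λ̄x - ry)`, used for `r² + |λ|² = 1`. -/
def euclRefl (r : ℝ) (l : Octonion) (w : OctPair) : OctPair :=
  (r • w.1 + l * w.2, conj l * w.1 - r • w.2)

/-- `F` extends the map of the coordinate patch `D` that reads `f` in the coordinates `φ`. -/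
def Extends (F : Equiv.Perm OP11) (D : Set OP11) (φ : OP11 → OctPair) (f : OctPair → OctPair) :
    Prop :=
  ∀ p ∈ D, F p ∈ D ∧ φ (F p) = f (φ p)

/-- `F` extends an indefinite reflection of `U₁/∼` or `U₂/∼` or a Euclidean reflection of
`U₃/∼`. -/
def ExtendsReflection (F : Equiv.Perm OP11) : Prop :=
  (∃ (r : ℝ) (l : Octonion), r ^ 2 - ‖l‖ ^ 2 = 1 ∧
    (Extends F D₁ φ₁ (indefRefl r l) ∨ Extends F D₂ φ₂ (indefRefl r l))) ∨
  (∃ (r : ℝ) (l : Octonion), r ^ 2 + ‖l‖ ^ 2 = 1 ∧ Extends F D₃ φ₃ (euclRefl r l))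

/-- The map of the patch `D` that reads `f` in the coordinates `φ` extends to one and only one
isometry of `OP11`, and this isometry is an involution. -/
def ExtendsToUniqueInvolutiveIsometry (g : SemiRiemannianMetric OctPair OP11) (D : Set OP11)
    (φ : OP11 → OctPair) (f : OctPair → OctPair) : Prop :=
  ∃ F : Equiv.Perm OP11, g.IsIsometry F ∧ Extends F D φ f ∧ F * F = 1 ∧
    ∀ F' : Equiv.Perm OP11, g.IsIsometry F' → Extends F' D φ f → F' = F

end OP11

end

/-! A line spanned by v is sent to the projection v v* / (v* v) onto it, a 3 × 3 octonionic matrix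
that is Hermitian for |a|² + |b|² - |c|². This embeds the plane in the real vector space `Herm`,
where everything becomes linear: the metric is half the pullback of the trace form, and the
reflections are restrictions of linear involutions preserving the trace and the trace form.

The embedding `emb` is well defined because the only nontrivial equivalence, (1, u, v) ∼ (u⁻¹, 1, v
u⁻¹), rescales v v* (`outer_inv_one`). `coordForm_self` identifies the pulled-back form with ds² in
the first chart; the second chart follows because swapping the first two coordinates preserves the
trace form. Completing the square in dv then gives nondegeneracy and signature, while a symmetric
form is determined by its values on the diagonal, whence uniqueness.

Nonassociativity matters when a reflection acts on v v*, since the product (λv)(ūλ) involves three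
octonions. A Moufang identity, `mul_mul_mul_conj_mul`, makes this product linear in u v̄, so the
reflection of vectors induces a linear map on `Herm` (`indefHerm_outer`, `euclHerm_outer`). The
image of `emb` is closed (`isClosed_range_emb`), so a linear reflection that sends a dense patch
into the image preserves the whole image. It therefore induces an involution of the plane, smooth
because the charts are smooth functions of the matrix entries (`contMDiff_of_emb`), and isometric
because the trace form is preserved (`IsReflection.exists_isometry`). Density of the patch also
makes the extension unique.

For transitivity, suitable reflections successively make the first coordinate nonzero, the second
zero and the third zero, bringing every point to [1, 0, 0]. -/

noncomputable section

/-! ### Octonion identities: adjoints of multiplications and a Moufang identity -/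

namespace Octonion

@[simp] theorem fst_neg (a : Octonion) : (-a).fst = -a.fst := rfl
@[simp] theorem snd_neg (a : Octonion) : (-a).snd = -a.snd := rfl

theorem inner_eq (a b : Octonion) : inner ℝ a b =
    a.fst.re * b.fst.re + a.fst.imI * b.fst.imI + a.fst.imJ * b.fst.imJ + a.fst.imK * b.fst.imK +
    (a.snd.re * b.snd.re + a.snd.imI * b.snd.imI + a.snd.imJ * b.snd.imJ +
      a.snd.imK * b.snd.imK) := by
  have h := norm_add_sq_real a b
  simp only [norm_sq_eq] at h
  simp at h
  linarith

theorem add_mul' (a b c : Octonion) : (a + b) * c = a * c + b * c := by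
  apply ext' <;> ext <;> simp <;> ring
theorem mul_add' (a b c : Octonion) : a * (b + c) = a * b + a * c := by
  apply ext' <;> ext <;> simp <;> ring
theorem neg_mul' (a b : Octonion) : -a * b = -(a * b) := by
  apply ext' <;> ext <;> simp <;> ring
theorem mul_neg' (a b : Octonion) : a * -b = -(a * b) := by
  apply ext' <;> ext <;> simp <;> ring
theorem conj_add (a b : Octonion) : (a + b).conj = a.conj + b.conj := by
  apply ext' <;> ext <;> simp <;> ring
theorem conj_neg (a : Octonion) : (-a).conj = -a.conj := by
  apply ext' <;> ext <;> simp
theorem conj_smul (r : ℝ) (a : Octonion) : (r • a).conj = r • a.conj := by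
  apply ext' <;> ext <;> simp
theorem conj_one : (1 : Octonion).conj = 1 := by
  apply ext' <;> ext <;> simp
theorem conj_zero : (0 : Octonion).conj = 0 := by
  apply ext' <;> ext <;> simp

theorem mul_conj_self (a : Octonion) : a * a.conj = ‖a‖ ^ 2 • (1 : Octonion) := by
  simpa [one_mul'] using mul_mul_conj 1 a

theorem inner_mul_left (a b c : Octonion) : inner ℝ (a * b) c = inner ℝ b (a.conj * c) := by
  simp only [inner_eq]; simp; ring
theorem inner_mul_right (a b c : Octonion) : inner ℝ (a * b) c = inner ℝ a (c * b.conj) := by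
  simp only [inner_eq]; simp; ring
theorem inner_conj_conj (a b : Octonion) : inner ℝ a.conj b.conj = inner ℝ a b := by
  simp only [inner_eq]; simp
theorem re_mul_eq_inner (a b : Octonion) : (a * b).re = inner ℝ a b.conj := by
  simp only [inner_eq, re]; simp; ring

/-- The polarized multiplicativity of the norm. -/
theorem inner_mul_mul_add (a b c d : Octonion) :
    inner ℝ (a * c) (b * d) + inner ℝ (a * d) (b * c) = 2 * (inner ℝ a b * inner ℝ c d) := by
  have h := norm_sq_mul (a + b) (c + d)
  have h1 := norm_sq_mul (a + b) c
  have h2 := norm_sq_mul (a + b) d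
  have h3 := norm_sq_mul a (c + d)
  have h4 := norm_sq_mul b (c + d)
  simp only [mul_add', add_mul', norm_add_sq_real, inner_add_left, inner_add_right, norm_sq_mul]
    at h h1 h2 h3 h4
  rw [real_inner_comm (b * c) (a * d)]
  linarith

/-- `(lv)(ūl) = 2 ⟨l, u v̄⟩ l - |l|² u v̄`, a form of a Moufang identity. -/
theorem mul_mul_mul_conj_mul (l u v : Octonion) :
    (l * v) * (u.conj * l) = (2 * inner ℝ l (u * v.conj)) • l - ‖l‖ ^ 2 • (u * v.conj) := by
  refine ext_inner_right ℝ fun w => ?_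
  have h := inner_mul_mul_add l w v (l.conj * u)
  have h1 : l * (l.conj * u) = ‖l‖ ^ 2 • u := by
    simpa only [conj_conj, norm_conj] using conj_mul_mul u l.conj
  have h2 : inner ℝ v (l.conj * u) = inner ℝ l (u * v.conj) := by
    rw [← inner_mul_left, inner_mul_right]
  have h3 : inner ℝ u (w * v) = inner ℝ (u * v.conj) w := by
    rw [inner_mul_right, conj_conj]
  rw [h1, h2, real_inner_smul_left, h3] at h
  rw [inner_mul_right, conj_mul, conj_conj, inner_sub_left, real_inner_smul_left,
    real_inner_smul_left]
  linarith

theorem inner_mul_mul_left (a b c : Octonion) :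
    inner ℝ (a * b) (a * c) = ‖a‖ ^ 2 * inner ℝ b c := by
  rw [inner_mul_left, conj_mul_mul, real_inner_smul_right]
theorem inner_mul_mul_right (a b c : Octonion) :
    inner ℝ (a * c) (b * c) = ‖c‖ ^ 2 * inner ℝ a b := by
  rw [inner_mul_right, mul_mul_conj, real_inner_smul_right]

theorem finrank_eq : Module.finrank ℝ Octonion = 8 := by
  have e : Octonion ≃ₗ[ℝ] ℍ[ℝ] × ℍ[ℝ] := WithLp.linearEquiv 2 ℝ (ℍ[ℝ] × ℍ[ℝ])
  rw [e.finrank_eq, Module.finrank_prod, Quaternion.finrank_eq_four]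

end Octonion
end

noncomputable section

/-! ### Hermitian matrices, the trace form and linear reflections -/

namespace OP11
open Octonion

/-- The space of octonionic `3 × 3` matrices that are Hermitian with respect to the form
`|a|² + |b|² - |c|²`: the diagonal entries `α, β, γ` and the entries `x, y, z` at the places
`ab̄`, `bc̄`, `ac̄`. -/
abbrev Herm : Type := ℝ × ℝ × ℝ × Octonion × Octonion × Octonion

/-- The trace form on `Herm`. -/
def traceForm : Herm →L[ℝ] Herm →L[ℝ] ℝ :=
  (LinearMap.mk₂ ℝ (fun X Y : Herm =>
    X.1 * Y.1 + X.2.1 * Y.2.1 + X.2.2.1 * Y.2.2.1 + 2 * inner ℝ X.2.2.2.1 Y.2.2.2.1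
      - 2 * inner ℝ X.2.2.2.2.1 Y.2.2.2.2.1 - 2 * inner ℝ X.2.2.2.2.2 Y.2.2.2.2.2)
    (fun X X' Y => by simp [inner_add_left]; ring)
    (fun r X Y => by simp [real_inner_smul_left]; ring)
    (fun X Y Y' => by simp [inner_add_right]; ring)
    (fun r X Y => by simp [real_inner_smul_right]; ring)).toContinuousBilinearMap

theorem traceForm_apply (X Y : Herm) : traceForm X Y =
    X.1 * Y.1 + X.2.1 * Y.2.1 + X.2.2.1 * Y.2.2.1 + 2 * inner ℝ X.2.2.2.1 Y.2.2.2.1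
      - 2 * inner ℝ X.2.2.2.2.1 Y.2.2.2.2.1 - 2 * inner ℝ X.2.2.2.2.2 Y.2.2.2.2.2 := rfl

theorem traceForm_comm (X Y : Herm) : traceForm X Y = traceForm Y X := by
  simp only [traceForm_apply, real_inner_comm X.2.2.2.1, real_inner_comm X.2.2.2.2.1,
    real_inner_comm X.2.2.2.2.2]
  ring

theorem traceForm_self (X : Herm) : traceForm X X =
    X.1 ^ 2 + X.2.1 ^ 2 + X.2.2.1 ^ 2 + 2 * ‖X.2.2.2.1‖ ^ 2
      - 2 * ‖X.2.2.2.2.1‖ ^ 2 - 2 * ‖X.2.2.2.2.2‖ ^ 2 := by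
  simp only [traceForm_apply, real_inner_self_eq_norm_sq]; ring

/-- The trace `α + β - γ`. -/
def trace : Herm →ₗ[ℝ] ℝ where
  toFun X := X.1 + X.2.1 - X.2.2.1
  map_add' X Y := by simp; ring
  map_smul' r X := by simp; ring

theorem trace_apply (X : Herm) : trace X = X.1 + X.2.1 - X.2.2.1 := rfl

/-- A linear involution of `Herm` that preserves the trace and the trace form. -/
structure IsReflection (L : Herm →ₗ[ℝ] Herm) : Prop where
  involutive (X : Herm) : L (L X) = X
  map_trace (X : Herm) : trace (L X) = trace X
  map_traceForm_self (X : Herm) : traceForm (L X) (L X) = traceForm X X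

theorem IsReflection.map_traceForm {L : Herm →ₗ[ℝ] Herm} (h : IsReflection L) (X Y : Herm) :
    traceForm (L X) (L Y) = traceForm X Y := by
  have h1 := h.map_traceForm_self (X + Y)
  simp only [map_add, add_apply, h.map_traceForm_self] at h1
  rw [traceForm_comm Y X, traceForm_comm (L Y) (L X)] at h1
  linarith

/-- The linear map induced by `(a, b, c) ↦ (b, a, c)`. -/
def swapHerm : Herm →ₗ[ℝ] Herm where
  toFun X := (X.2.1, X.1, X.2.2.1, conj X.2.2.2.1, X.2.2.2.2.2, X.2.2.2.2.1)
  map_add' X Y := by simp [conj_add]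
  map_smul' r X := by simp [conj_smul]

theorem isReflection_swapHerm : IsReflection swapHerm where
  involutive X := by simp [swapHerm, conj_conj]
  map_trace X := by simp [swapHerm, trace_apply]; ring
  map_traceForm_self X := by simp [swapHerm, traceForm_self, norm_conj]; ring

/-- The linear map induced by `(a, b, c) ↦ (a, -rb + λc, -λ̄b + rc)`. -/
def indefHerm (r : ℝ) (l : Octonion) : Herm →ₗ[ℝ] Herm where
  toFun X := (X.1,
    r ^ 2 * X.2.1 + ‖l‖ ^ 2 * X.2.2.1 - 2 * r * inner ℝ l X.2.2.2.2.1,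
    ‖l‖ ^ 2 * X.2.1 + r ^ 2 * X.2.2.1 - 2 * r * inner ℝ l X.2.2.2.2.1,
    -(r • X.2.2.2.1) + X.2.2.2.2.2 * conj l,
    (r * (X.2.1 + X.2.2.1) - 2 * inner ℝ l X.2.2.2.2.1) • l - X.2.2.2.2.1,
    -(X.2.2.2.1 * l) + r • X.2.2.2.2.2)
  map_add' X Y := by
    simp only [Prod.fst_add, Prod.snd_add, inner_add_right, add_mul', smul_add, Prod.mk_add_mk,
      Prod.mk.injEq, true_and]
    refine ⟨by ring, by ring, by abel, ?_, by abel⟩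
    module
  map_smul' s X := by
    simp only [Prod.smul_fst, Prod.smul_snd, real_inner_smul_right, smul_mul', Prod.smul_mk,
      Prod.mk.injEq, true_and, smul_eq_mul, RingHom.id_apply]
    refine ⟨by ring, by ring, by module, by module, by module⟩

/-- The relation r² - |λ|² = 1 has already been used to give the entry b c̄ the coefficient -1 in
`indefHerm`; here it enters as |λ|² = r² - 1. -/
theorem isReflection_indefHerm {r : ℝ} {l : Octonion} (h : r ^ 2 - ‖l‖ ^ 2 = 1) :
    IsReflection (indefHerm r l) where
  involutive X := by
    obtain ⟨a, b, c, x, y, z⟩ := X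
    have hl : ‖l‖ ^ 2 = r ^ 2 - 1 := by linarith
    simp only [indefHerm, LinearMap.coe_mk, AddHom.coe_mk, inner_sub_right, real_inner_smul_right,
      real_inner_self_eq_norm_sq, add_mul', neg_mul', smul_mul', mul_mul_conj, mul_conj_mul,
      Prod.mk.injEq, true_and, hl]
    refine ⟨by ring, by ring, ?_, ?_, ?_⟩ <;> module
  map_trace X := by
    simp only [indefHerm, LinearMap.coe_mk, AddHom.coe_mk, trace_apply]
    linear_combination (X.2.1 - X.2.2.1) * h
  map_traceForm_self X := by
    obtain ⟨a, b, c, x, y, z⟩ := X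
    have hl : ‖l‖ ^ 2 = r ^ 2 - 1 := by linarith
    -- The norms of the new x and z entries occur with opposite signs in the trace form; by this
    -- adjunction their cross terms cancel.
    have h1 : inner ℝ x (z * conj l) = inner ℝ (x * l) z := (inner_mul_right x l z).symm
    simp only [indefHerm, LinearMap.coe_mk, AddHom.coe_mk, traceForm_self, norm_add_sq_real,
      norm_sub_sq_real, norm_neg, inner_neg_left, real_inner_smul_left, real_inner_smul_right,
      norm_smul, mul_pow, norm_sq_mul, norm_conj, Real.norm_eq_abs, sq_abs, hl, h1]
    ring

/-- The linear map induced by `(a, b, c) ↦ (ra + λb, λ̄a - rb, c)`. -/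
def euclHerm (r : ℝ) (l : Octonion) : Herm →ₗ[ℝ] Herm where
  toFun X := (r ^ 2 * X.1 + ‖l‖ ^ 2 * X.2.1 + 2 * r * inner ℝ l X.2.2.2.1,
    ‖l‖ ^ 2 * X.1 + r ^ 2 * X.2.1 - 2 * r * inner ℝ l X.2.2.2.1,
    X.2.2.1,
    (r * (X.1 - X.2.1) + 2 * inner ℝ l X.2.2.2.1) • l - X.2.2.2.1,
    conj l * X.2.2.2.2.2 - r • X.2.2.2.2.1,
    r • X.2.2.2.2.2 + l * X.2.2.2.2.1)
  map_add' X Y := by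
    simp only [Prod.fst_add, Prod.snd_add, inner_add_right, mul_add', smul_add, Prod.mk_add_mk,
      Prod.mk.injEq, true_and]
    refine ⟨by ring, by ring, ?_, by abel, by abel⟩
    module
  map_smul' s X := by
    simp only [Prod.smul_fst, Prod.smul_snd, real_inner_smul_right, mul_smul', Prod.smul_mk,
      Prod.mk.injEq, true_and, smul_eq_mul, RingHom.id_apply]
    refine ⟨by ring, by ring, by module, by module, by module⟩

theorem isReflection_euclHerm {r : ℝ} {l : Octonion} (h : r ^ 2 + ‖l‖ ^ 2 = 1) :
    IsReflection (euclHerm r l) where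
  involutive X := by
    obtain ⟨a, b, c, x, y, z⟩ := X
    have hl : ‖l‖ ^ 2 = 1 - r ^ 2 := by linarith
    have h1 : l * (conj l * z) = ‖l‖ ^ 2 • z := by
      simpa only [conj_conj, norm_conj] using conj_mul_mul z l.conj
    simp only [euclHerm, LinearMap.coe_mk, AddHom.coe_mk, real_inner_smul_right,
      real_inner_self_eq_norm_sq, sub_eq_add_neg, mul_add', mul_neg', mul_smul', conj_mul_mul, h1,
      Prod.mk.injEq, true_and, hl, inner_add_right, inner_neg_right]
    refine ⟨by ring, by ring, ?_, ?_, ?_⟩ <;> module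
  map_trace X := by
    simp only [euclHerm, LinearMap.coe_mk, AddHom.coe_mk, trace_apply]
    linear_combination (X.1 + X.2.1) * h
  map_traceForm_self X := by
    obtain ⟨a, b, c, x, y, z⟩ := X
    have hl : ‖l‖ ^ 2 = 1 - r ^ 2 := by linarith
    -- The new y and z entries occur with equal signs in the trace form, but their cross terms have
    -- opposite signs and cancel by this adjunction.
    have h1 : inner ℝ z (l * y) = inner ℝ (conj l * z) y := by
      rw [inner_mul_left, conj_conj]
    simp only [euclHerm, LinearMap.coe_mk, AddHom.coe_mk, traceForm_self, norm_add_sq_real,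
      norm_sub_sq_real, real_inner_smul_left, real_inner_smul_right,
      norm_smul, mul_pow, norm_sq_mul, norm_conj, Real.norm_eq_abs, sq_abs, hl, h1]
    ring

/-! ### The embedding by projections onto lines -/

/-- The Hermitian matrix `v v*` of a vector `v = (a, b, c)`. -/
def outer (a b c : Octonion) : Herm :=
  (‖a‖ ^ 2, ‖b‖ ^ 2, ‖c‖ ^ 2, a * conj b, b * conj c, a * conj c)

theorem trace_outer (a b c : Octonion) : trace (outer a b c) = ‖a‖ ^ 2 + ‖b‖ ^ 2 - ‖c‖ ^ 2 := rfl

theorem swapHerm_outer (a b c : Octonion) : swapHerm (outer a b c) = outer b a c := by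
  simp [swapHerm, outer, conj_mul, conj_conj]

/-- The entry b c̄ is the delicate one: its term (λv)(ūλ) involves three octonions, and the Moufang
identity turns it into a linear expression in u v̄. The remaining products need only alternativity.
-/
theorem indefHerm_outer {r : ℝ} {l : Octonion} (h : r ^ 2 - ‖l‖ ^ 2 = 1) (u v : Octonion) :
    indefHerm r l (outer 1 u v) =
      outer 1 (indefRefl r l (u, v)).1 (indefRefl r l (u, v)).2 := by
  have hl : ‖l‖ ^ 2 = r ^ 2 - 1 := by linarith
  have h1 : inner ℝ u (l * v) = inner ℝ l (u * conj v) := by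
    rw [real_inner_comm, inner_mul_right]
  have h2 : inner ℝ (conj l * u) v = inner ℝ l (u * conj v) := by
    rw [inner_mul_left, conj_conj, h1]
  have h3 := mul_mul_mul_conj_mul l u v
  have h4 : u * (conj u * l) = ‖u‖ ^ 2 • l := by
    simpa only [conj_conj, norm_conj] using conj_mul_mul l u.conj
  simp only [indefHerm, outer, indefRefl, LinearMap.coe_mk, AddHom.coe_mk, one_mul', conj_add,
    conj_neg, conj_smul, conj_mul, conj_conj, mul_add', add_mul', neg_mul', mul_neg', smul_mul',
    mul_smul', norm_add_sq_real, norm_neg, norm_smul, norm_sq_mul, norm_conj, mul_pow,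
    Real.norm_eq_abs, sq_abs, inner_neg_left, real_inner_smul_left, real_inner_smul_right, h1, h2,
    h3, h4, mul_mul_conj, Prod.mk.injEq, true_and, and_true, hl]
  exact ⟨by ring, by ring, by module⟩

/-- As for `indefHerm_outer`, with the Moufang identity now applied to the entry a b̄. -/
theorem euclHerm_outer {r : ℝ} {l : Octonion} (h : r ^ 2 + ‖l‖ ^ 2 = 1) (x y : Octonion) :
    euclHerm r l (outer x y 1) =
      outer (euclRefl r l (x, y)).1 (euclRefl r l (x, y)).2 1 := by
  have hl : ‖l‖ ^ 2 = 1 - r ^ 2 := by linarith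
  have h1 : inner ℝ x (l * y) = inner ℝ l (x * conj y) := by
    rw [real_inner_comm, inner_mul_right]
  have h2 : inner ℝ (conj l * x) y = inner ℝ l (x * conj y) := by
    rw [inner_mul_left, conj_conj, h1]
  have h3 := mul_mul_mul_conj_mul l x y
  have h4 : x * (conj x * l) = ‖x‖ ^ 2 • l := by
    simpa only [conj_conj, norm_conj] using conj_mul_mul l x.conj
  simp only [euclHerm, outer, euclRefl, LinearMap.coe_mk, AddHom.coe_mk, mul_one', conj_one,
    sub_eq_add_neg, conj_add,
    conj_neg, conj_smul, conj_mul, conj_conj, mul_add', add_mul', mul_neg', smul_mul',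
    mul_smul', norm_add_sq_real, norm_neg, norm_smul, norm_sq_mul, norm_conj, mul_pow,
    Real.norm_eq_abs, sq_abs, inner_neg_right, real_inner_smul_left, real_inner_smul_right, h1, h2,
    h3, h4, mul_mul_conj, Prod.mk.injEq, true_and, and_true, hl]
  exact ⟨by ring, by ring, by module⟩

/-- Every entry involves at most the two octonions u and v, so alternativity suffices to pull out
the common factor |u|⁻². -/
theorem outer_inv_one {u v : Octonion} (hu : u ≠ 0) :
    outer u⁻¹ 1 (v * u⁻¹) = (‖u‖ ^ 2)⁻¹ • outer 1 u v := by
  have h0 := norm_sq_ne hu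
  have hn := norm_ne_zero_iff.2 hu
  simp only [outer, Prod.smul_mk, Prod.mk.injEq, norm_mul', norm_inv', norm_one', conj_one, mul_one',
    one_mul', conj_mul, smul_eq_mul]
  have h1 : conj u⁻¹ = (‖u‖ ^ 2)⁻¹ • u := by rw [inv_def, conj_smul, conj_conj]
  refine ⟨by simp, by field_simp, by field_simp, rfl, by rw [h1, smul_mul'], ?_⟩
  rw [h1, inv_def, smul_mul', smul_mul', mul_smul', conj_mul_mul, smul_smul (‖u‖ ^ 2)⁻¹ (‖u‖ ^ 2),
    inv_mul_cancel₀ h0, one_smul]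

/-- The Hermitian projection `v v* / (v* v)` onto the line of `v = (a, b, c)`. -/
def lineProj (a b c : Octonion) : Herm := (trace (outer a b c))⁻¹ • outer a b c

theorem lineProj_eq_of_outer_eq_smul {a b c a' b' c' : Octonion} {s : ℝ} (hs : s ≠ 0)
    (h : outer a' b' c' = s • outer a b c) : lineProj a' b' c' = lineProj a b c := by
  rw [lineProj, h, map_smul, smul_smul, smul_eq_mul, mul_inv_rev, mul_assoc,
    inv_mul_cancel₀ hs, mul_one, lineProj]

theorem lineProj_inv_one {u v : Octonion} (hu : u ≠ 0) :
    lineProj u⁻¹ 1 (v * u⁻¹) = lineProj 1 u v :=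
  lineProj_eq_of_outer_eq_smul (inv_ne_zero (norm_sq_ne hu)) (outer_inv_one hu)

/-- The embedding of `OP11` into the Hermitian matrices that sends a line to the projection
onto it. -/
def emb (p : OP11) : Herm :=
  Quotient.lift (fun x : Coords => lineProj x.1.1 x.1.2.1 x.1.2.2) (fun x y h => by
    rcases rel_cases x.2 y.2 h with e | ⟨u, v, hu, ⟨e1, e2⟩ | ⟨e1, e2⟩⟩
    · rw [e]
    · rw [e1, e2, lineProj_inv_one hu]
    · rw [e1, e2, lineProj_inv_one hu]) p

theorem emb_cls (x : Coords) : emb (cls x) = lineProj x.1.1 x.1.2.1 x.1.2.2 := rfl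

/-- The embedding in the coordinates of `U₁/∼`. -/
def param (w : OctPair) : Herm := lineProj 1 w.1 w.2

theorem trace_outer_one (w : OctPair) :
    trace (outer 1 w.1 w.2) = 1 + ‖w.1‖ ^ 2 - ‖w.2‖ ^ 2 := by
  rw [trace_outer, norm_one', one_pow]

theorem IsReflection.map_lineProj {L : Herm →ₗ[ℝ] Herm} (hL : IsReflection L)
    {a b c a' b' c' : Octonion} (h : L (outer a b c) = outer a' b' c') :
    L (lineProj a b c) = lineProj a' b' c' := by
  rw [lineProj, map_smul, h, lineProj, ← h, hL.map_trace]

theorem emb_pt₁ (w : target) : emb (pt₁ w) = param w := rfl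
theorem emb_pt₂ (w : target) : emb (pt₂ w) = swapHerm (param w) :=
  (isReflection_swapHerm.map_lineProj (swapHerm_outer _ _ _)).symm

theorem emb_eq_of_mem_D₁ {p : OP11} (h : p ∈ D₁) : emb p = param (φ₁ p) := by
  obtain ⟨w, rfl⟩ := mem_D₁.1 h
  rw [emb_pt₁, φ₁_pt₁]
theorem emb_eq_of_mem_D₂ {p : OP11} (h : p ∈ D₂) : emb p = swapHerm (param (φ₂ p)) := by
  obtain ⟨w, rfl⟩ := mem_D₂.1 h
  rw [emb_pt₂, φ₂_pt₂]

/-- The coordinates of `U₁/∼` as functions on the Hermitian matrices. -/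
def coord (X : Herm) : OctPair := (X.1⁻¹ • conj X.2.2.2.1, X.1⁻¹ • conj X.2.2.2.2.2)

theorem coord_param {w : OctPair} (h : w ∈ target) : coord (param w) = w := by
  have h0 : 1 + ‖w.1‖ ^ 2 - ‖w.2‖ ^ 2 ≠ 0 := ne_of_gt h
  simp only [coord, param, lineProj, trace_outer_one]
  simp [outer, norm_one', one_mul', conj_smul, conj_conj, smul_smul, mul_inv_cancel₀ h0]

theorem contDiffAt_coord {n : WithTop ℕ∞} {X : Herm} (h : X.1 ≠ 0) : ContDiffAt ℝ n coord X := by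
  have h1 : ContDiffAt ℝ n (fun X : Herm => X.1⁻¹) X := contDiffAt_fst.inv h
  refine (h1.smul (contDiff_conj.contDiffAt.comp X ?_)).prodMk
    (h1.smul (contDiff_conj.contDiffAt.comp X ?_)) <;> fun_prop

theorem coord_emb {p : OP11} (h : p ∈ D₁) : coord (emb p) = φ₁ p := by
  rw [emb_eq_of_mem_D₁ h, @coord_param (φ₁ p) (chart₁.map_source h)]
theorem coord_swapHerm_emb {p : OP11} (h : p ∈ D₂) : coord (swapHerm (emb p)) = φ₂ p := by
  rw [emb_eq_of_mem_D₂ h, isReflection_swapHerm.involutive, @coord_param (φ₂ p) (chart₂.map_source h)]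

theorem trace_outer_pos (x : Coords) : 0 < trace (outer x.1.1 x.1.2.1 x.1.2.2) := by
  obtain ⟨⟨a, b, c⟩, ⟨h, h'⟩ | ⟨h, h'⟩⟩ := x <;> simp only at h h' <;> subst h <;>
    simpa [trace_outer, norm_one'] using h'

/-- The first diagonal entry is |a|² divided by a positive number. Hence a map that fixes this entry
preserves the patch; the next two lemmas serve the other patches in the same way. -/
theorem mem_D₁_iff {p : OP11} : p ∈ D₁ ↔ (emb p).1 ≠ 0 := by
  induction p using ind with
  | h x =>
    rw [cls_mem_D₁, emb_cls]
    change _ ↔ (trace (outer x.1.1 x.1.2.1 x.1.2.2))⁻¹ * ‖x.1.1‖ ^ 2 ≠ 0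
    simp [(trace_outer_pos x).ne']
theorem mem_D₂_iff {p : OP11} : p ∈ D₂ ↔ (emb p).2.1 ≠ 0 := by
  induction p using ind with
  | h x =>
    rw [cls_mem_D₂, emb_cls]
    change _ ↔ (trace (outer x.1.1 x.1.2.1 x.1.2.2))⁻¹ * ‖x.1.2.1‖ ^ 2 ≠ 0
    simp [(trace_outer_pos x).ne']
theorem mem_D₃_iff {p : OP11} : p ∈ D₃ ↔ (emb p).2.2.1 ≠ 0 := by
  have aux (x : Coords) : (emb (cls x)).2.2.1 ≠ 0 ↔ x.1.2.2 ≠ 0 := by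
    change (trace (outer x.1.1 x.1.2.1 x.1.2.2))⁻¹ * ‖x.1.2.2‖ ^ 2 ≠ 0 ↔ _
    simp [(trace_outer_pos x).ne']
  constructor
  · rintro ⟨x, hx, rfl⟩
    exact (aux x).2 hx
  · induction p using ind with
    | h x => exact fun h => ⟨x, (aux x).1 h, rfl⟩

/-- The diagonal entries tell in which patch a point lies, and `coord` recovers its coordinates
there. -/
theorem emb_injective : Function.Injective emb := by
  intro p q h
  rcases mem_D₁_or_D₂ p with hp | hp
  · have hq : q ∈ D₁ := by rwa [mem_D₁_iff, ← h, ← mem_D₁_iff]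
    refine chart₁.injOn hp hq ?_
    change φ₁ p = φ₁ q
    rw [← coord_emb hp, ← coord_emb hq, h]
  · have hq : q ∈ D₂ := by rwa [mem_D₂_iff, ← h, ← mem_D₂_iff]
    refine chart₂.injOn hp hq ?_
    change φ₂ p = φ₂ q
    rw [← coord_swapHerm_emb hp, ← coord_swapHerm_emb hq, h]

/-- Rescaling by c⁻¹ is harmless because one of a, b equals 1: the entry (a c⁻¹) conj(b c⁻¹) then
involves only two octonions. For arbitrary a, b, c alternativity would not suffice. -/
theorem lineProj_mul_inv {x : Coords} (h : x.1.2.2 ≠ 0) :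
    lineProj (x.1.1 * x.1.2.2⁻¹) (x.1.2.1 * x.1.2.2⁻¹) 1 =
      lineProj x.1.1 x.1.2.1 x.1.2.2 := by
  refine lineProj_eq_of_outer_eq_smul (inv_ne_zero (norm_sq_ne h)) ?_
  obtain ⟨⟨a, b, c⟩, hx⟩ := x
  dsimp only at h ⊢
  have hn := norm_ne_zero_iff.2 h
  have h1 : c.conj * (c * b.conj) = ‖c‖ ^ 2 • b.conj := conj_mul_mul _ _
  have h2 : (a * c.conj) * c = ‖c‖ ^ 2 • a := mul_conj_mul _ _
  simp only [outer, Prod.smul_mk, Prod.mk.injEq, norm_mul', norm_inv', norm_one', conj_one,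
    mul_one', smul_eq_mul]
  simp only [inv_def, mul_smul', smul_mul', conj_smul, conj_mul, conj_conj, smul_smul, and_true]
  refine ⟨by field_simp, by field_simp, by field_simp, ?_⟩
  rcases hx with ⟨hx, -⟩ | ⟨hx, -⟩ <;> simp only at hx <;> subst hx
  · rw [one_mul', one_mul', h1, smul_smul]; congr 1; field_simp
  · rw [conj_one, mul_one', mul_one', h2, smul_smul]; congr 1; field_simp

theorem emb_eq_of_mem_D₃ {p : OP11} (h : p ∈ D₃) : emb p = lineProj (φ₃ p).1 (φ₃ p).2 1 := by
  obtain ⟨x, hx, rfl⟩ := h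
  exact (lineProj_mul_inv hx).symm

theorem trace_outer_φ₃_pos {p : OP11} (h : p ∈ D₃) : 0 < trace (outer (φ₃ p).1 (φ₃ p).2 1) := by
  -- The third coordinate is normalized to 1, so the third diagonal entry is the inverse of the
  -- trace, which is therefore positive as soon as the entry is nonnegative and nonzero.
  have h1 : (emb p).2.2.1 = (trace (outer (φ₃ p).1 (φ₃ p).2 1))⁻¹ := by
    rw [emb_eq_of_mem_D₃ h]; simp [lineProj, outer, norm_one']
  have h2 : 0 ≤ (emb p).2.2.1 := by
    induction p using ind with
    | h x =>
      rw [emb_cls]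
      exact mul_nonneg (inv_nonneg.2 (trace_outer_pos x).le) (sq_nonneg _)
  rw [h1] at h2
  refine lt_of_le_of_ne (inv_nonneg.1 h2) fun h3 => mem_D₃_iff.1 h ?_
  rw [h1, ← h3, inv_zero]

/-- The coordinates of `U₃/∼` are determined by the embedding. -/
theorem φ₃_eq {p : OP11} (h : p ∈ D₃) :
    φ₃ p = ((emb p).2.2.1⁻¹ • (emb p).2.2.2.2.2, (emb p).2.2.1⁻¹ • (emb p).2.2.2.2.1) := by
  have h0 := (trace_outer_φ₃_pos h).ne'
  rw [emb_eq_of_mem_D₃ h]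
  generalize φ₃ p = w at h0 ⊢
  unfold lineProj
  generalize trace (outer w.1 w.2 1) = t at h0 ⊢
  simp [outer, norm_one', conj_one, mul_one', smul_smul, mul_inv_cancel₀ h0]

/-! ### The image of the embedding as a closed set -/

/-- The equations satisfied by the projections onto lines. -/
structure IsLineProj (X : Herm) : Prop where
  nonneg₁ : 0 ≤ X.1
  nonneg₂ : 0 ≤ X.2.1
  nonneg₃ : 0 ≤ X.2.2.1
  trace_eq : X.1 + X.2.1 - X.2.2.1 = 1
  mul₁₂ : X.1 * X.2.1 = ‖X.2.2.2.1‖ ^ 2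
  mul₁₃ : X.1 * X.2.2.1 = ‖X.2.2.2.2.2‖ ^ 2
  mul₂₃ : X.2.1 * X.2.2.1 = ‖X.2.2.2.2.1‖ ^ 2
  smul₁ : X.1 • X.2.2.2.2.1 = conj X.2.2.2.1 * X.2.2.2.2.2
  smul₂ : X.2.1 • X.2.2.2.2.2 = X.2.2.2.1 * X.2.2.2.2.1

theorem IsLineProj.swapHerm {X : Herm} (h : IsLineProj X) : IsLineProj (swapHerm X) where
  nonneg₁ := h.nonneg₂
  nonneg₂ := h.nonneg₁
  nonneg₃ := h.nonneg₃
  trace_eq := by rw [← h.trace_eq, OP11.swapHerm, LinearMap.coe_mk, AddHom.coe_mk]; ring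
  mul₁₂ := by
    simp only [OP11.swapHerm, LinearMap.coe_mk, AddHom.coe_mk, norm_conj, ← h.mul₁₂]; ring
  mul₁₃ := h.mul₂₃
  mul₂₃ := h.mul₁₃
  smul₁ := by
    simp only [OP11.swapHerm, LinearMap.coe_mk, AddHom.coe_mk, conj_conj, ← h.smul₂]
  smul₂ := h.smul₁

/-- The hypotheses `h1` and `h2` stand in for associativity; they are easily checked when one of the
coordinates is 1. -/
theorem isLineProj_lineProj {a b c : Octonion} (h : 0 < trace (outer a b c))
    (h1 : conj (a * conj b) * (a * conj c) = ‖a‖ ^ 2 • (b * conj c))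
    (h2 : (a * conj b) * (b * conj c) = ‖b‖ ^ 2 • (a * conj c)) : IsLineProj (lineProj a b c) := by
  have h0 : trace (outer a b c) ≠ 0 := h.ne'
  have ht : ‖a‖ ^ 2 + ‖b‖ ^ 2 - ‖c‖ ^ 2 = trace (outer a b c) := rfl
  unfold lineProj
  generalize trace (outer a b c) = t at *
  constructor <;> simp only [outer, Prod.smul_mk, smul_eq_mul]
  · positivity
  · positivity
  · positivity
  · rw [← mul_add, ← mul_sub, ht, inv_mul_cancel₀ h0]
  all_goals simp only [norm_smul, norm_mul', norm_conj, mul_pow, Real.norm_eq_abs, sq_abs, conj_smul,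
    smul_mul', mul_smul', h1, h2, smul_smul]
  iterate 3 ring
  iterate 2 (congr 1; ring)

theorem isLineProj_param {w : OctPair} (h : w ∈ target) : IsLineProj (param w) := by
  refine isLineProj_lineProj ?_ ?_ ?_
  · rw [trace_outer_one]; exact h
  · simp [one_mul', conj_conj, norm_one']
  · rw [one_mul', one_mul', conj_mul_mul]

theorem isLineProj_emb (p : OP11) : IsLineProj (emb p) := by
  rcases mem_D₁_or_D₂ p with h | h
  · rw [emb_eq_of_mem_D₁ h]; exact isLineProj_param (chart₁.map_source h)
  · rw [emb_eq_of_mem_D₂ h]; exact (isLineProj_param (chart₂.map_source h)).swapHerm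

/-- With X.1 ≠ 0 as pivot, `coord X` determines the line, and the rank-one equations recover the
other entries. The trace condition divided by X.1 says that 1 + |u|² - |v|² = X.1⁻¹, which is
positive. -/
theorem IsLineProj.exists_param {X : Herm} (h : IsLineProj X) (h0 : X.1 ≠ 0) :
    ∃ w : target, X = param w := by
  have ht : 1 + ‖(coord X).1‖ ^ 2 - ‖(coord X).2‖ ^ 2 = X.1⁻¹ := by
    have h1 := h.mul₁₂
    have h2 := h.mul₁₃
    have h3 := h.trace_eq
    simp only [coord, norm_smul, norm_conj, mul_pow, ← h1, ← h2, norm_inv, Real.norm_eq_abs, inv_pow,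
      sq_abs]
    field_simp
    linarith
  have hpos : 0 < X.1⁻¹ := inv_pos.2 (lt_of_le_of_ne h.nonneg₁ h0.symm)
  refine ⟨⟨coord X, by rw [target, Set.mem_ofPred_eq, ht]; exact hpos⟩, ?_⟩
  have h1 : X.2.1 = X.1⁻¹ * ‖X.2.2.2.1‖ ^ 2 := by rw [← h.mul₁₂]; field_simp
  have h2 : X.2.2.1 = X.1⁻¹ * ‖X.2.2.2.2.2‖ ^ 2 := by rw [← h.mul₁₃]; field_simp
  have h3 : X.2.2.2.2.1 = X.1⁻¹ • (conj X.2.2.2.1 * X.2.2.2.2.2) := by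
    rw [← h.smul₁, smul_smul, inv_mul_cancel₀ h0, one_smul]
  simp only [param, lineProj, trace_outer_one, ht, inv_inv]
  obtain ⟨a, b, c, x, y, z⟩ := X
  simp only [coord, outer] at h0 h1 h2 h3 ⊢
  simp only [Prod.smul_mk, Prod.mk.injEq, smul_eq_mul, norm_smul, norm_conj, norm_one', mul_pow,
    norm_inv, Real.norm_eq_abs, inv_pow, sq_abs, conj_smul, conj_conj, one_mul', smul_mul',
    mul_smul', smul_smul, mul_inv_cancel₀ h0, one_smul, and_true, h1, h2, h3]
  refine ⟨by ring, by field_simp, by field_simp, trivial, ?_⟩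
  congr 1; field_simp

/-- The image of the embedding is cut out by closed conditions. -/
theorem range_emb : Set.range emb = {X | IsLineProj X} := by
  ext X
  constructor
  · rintro ⟨p, rfl⟩; exact isLineProj_emb p
  · intro h
    by_cases h0 : X.1 = 0
    · have h1 : (swapHerm X).1 ≠ 0 := by
        -- If both of the first two diagonal entries vanished, trace 1 would force the third to be
        -- -1. So one of the two can always serve as pivot, which is why no equation with the third
        -- entry as pivot is needed.
        intro h1
        change X.2.1 = 0 at h1
        have h2 := h.trace_eq
        have h3 := h.nonneg₃
        rw [h0, h1] at h2
        linarith
      obtain ⟨w, hw⟩ := h.swapHerm.exists_param h1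
      exact ⟨pt₂ w, by rw [emb_pt₂, ← hw, isReflection_swapHerm.involutive]⟩
    · obtain ⟨w, hw⟩ := h.exists_param h0
      exact ⟨pt₁ w, by rw [emb_pt₁, hw]⟩

theorem isClosed_range_emb : IsClosed (Set.range emb) := by
  have hmul : Continuous fun p : Octonion × Octonion => p.1 * p.2 := continuous_mul'
  have hconj : Continuous conj := (contDiff_conj (n := 0)).continuous
  have : Set.range emb = {X : Herm | 0 ≤ X.1 ∧ 0 ≤ X.2.1 ∧ 0 ≤ X.2.2.1 ∧
      X.1 + X.2.1 - X.2.2.1 = 1 ∧ X.1 * X.2.1 = ‖X.2.2.2.1‖ ^ 2 ∧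
      X.1 * X.2.2.1 = ‖X.2.2.2.2.2‖ ^ 2 ∧ X.2.1 * X.2.2.1 = ‖X.2.2.2.2.1‖ ^ 2 ∧
      X.1 • X.2.2.2.2.1 = conj X.2.2.2.1 * X.2.2.2.2.2 ∧
      X.2.1 • X.2.2.2.2.2 = X.2.2.2.1 * X.2.2.2.2.1} := by
    rw [range_emb]; ext X
    exact ⟨fun ⟨a, b, c, d, e, f, g, h, i⟩ => ⟨a, b, c, d, e, f, g, h, i⟩,
      fun ⟨a, b, c, d, e, f, g, h, i⟩ => ⟨a, b, c, d, e, f, g, h, i⟩⟩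
  rw [this]
  have h0 : Continuous fun X : Herm => conj X.2.2.2.1 := hconj.comp (by fun_prop)
  have h1 : Continuous fun X : Herm => conj X.2.2.2.1 * X.2.2.2.2.2 :=
    hmul.comp (f := fun X : Herm => (conj X.2.2.2.1, X.2.2.2.2.2)) (by fun_prop)
  have h2 : Continuous fun X : Herm => X.2.2.2.1 * X.2.2.2.2.1 :=
    hmul.comp (f := fun X : Herm => (X.2.2.2.1, X.2.2.2.2.1)) (by fun_prop)
  refine IsClosed.and (isClosed_le (by fun_prop) (by fun_prop)) ?_
  refine IsClosed.and (isClosed_le (by fun_prop) (by fun_prop)) ?_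
  refine IsClosed.and (isClosed_le (by fun_prop) (by fun_prop)) ?_
  refine IsClosed.and (isClosed_eq (by fun_prop) (by fun_prop)) ?_
  refine IsClosed.and (isClosed_eq (by fun_prop) (by fun_prop)) ?_
  refine IsClosed.and (isClosed_eq (by fun_prop) (by fun_prop)) ?_
  refine IsClosed.and (isClosed_eq (by fun_prop) (by fun_prop)) ?_
  exact IsClosed.and (isClosed_eq (by fun_prop) h1) (isClosed_eq (by fun_prop) h2)

end OP11
end

/-! ### Smoothness of bilinear fields and of the embedding -/

noncomputable section

set_option maxSynthPendingDepth 3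

/-- A field of bilinear forms is smooth if it is smooth in the preferred charts. -/
theorem contMDiffAt_bilin_of_chart {E : Type*} [NormedAddCommGroup E] [NormedSpace ℝ E]
    {M : Type*} [TopologicalSpace M] [ChartedSpace E M] [IsManifold 𝓘(ℝ, E) ∞ M]
    (val : ∀ p : M, TangentSpace 𝓘(ℝ, E) p →L[ℝ] TangentSpace 𝓘(ℝ, E) p →L[ℝ] ℝ) (p₀ : M)
    (G : E → E →L[ℝ] E →L[ℝ] ℝ) (hG : ContDiffAt ℝ ∞ G (chartAt E p₀ p₀))
    (h : ∀ p ∈ (chartAt E p₀).source, ∀ X Y : TangentSpace 𝓘(ℝ, E) p,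
      val p X Y = G (chartAt E p₀ p) (mfderiv 𝓘(ℝ, E) 𝓘(ℝ, E) (chartAt E p₀) p X)
        (mfderiv 𝓘(ℝ, E) 𝓘(ℝ, E) (chartAt E p₀) p Y)) :
    ContMDiffAt 𝓘(ℝ, E) (𝓘(ℝ, E).prod 𝓘(ℝ, E →L[ℝ] E →L[ℝ] ℝ)) ∞
      (fun p : M => Bundle.TotalSpace.mk' (E →L[ℝ] E →L[ℝ] ℝ) p (val p)) p₀ := by
  rw [contMDiffAt_hom_bundle]
  refine ⟨contMDiffAt_id, ?_⟩
  have h1 : ContMDiffAt 𝓘(ℝ, E) 𝓘(ℝ, E →L[ℝ] E →L[ℝ] ℝ) ∞ (G ∘ chartAt E p₀) p₀ :=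
    hG.contMDiffAt.comp p₀ (contMDiffAt_of_mem_maximalAtlas
      (IsManifold.chart_mem_maximalAtlas p₀) (mem_chart_source E p₀))
  refine h1.congr_of_eventuallyEq ?_
  filter_upwards [(chartAt E p₀).open_source.mem_nhds (mem_chart_source E p₀)] with p hp
  have hb : p ∈ (trivializationAt E (TangentSpace 𝓘(ℝ, E)) p₀).baseSet := hp
  -- On the chart domain the tangent bundle trivialization is the differential of the preferred
  -- chart, so in that trivialization the field reads `G` composed with the chart.
  have h2 := TangentBundle.continuousLinearMapAt_trivializationAt (I := 𝓘(ℝ, E)) hp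
  set T := trivializationAt E (TangentSpace 𝓘(ℝ, E)) p₀
  have h3 (X Y : TangentSpace 𝓘(ℝ, E) p) : val p X Y = G (chartAt E p₀ p)
      (T.continuousLinearMapAt ℝ p X) (T.continuousLinearMapAt ℝ p Y) := by
    rw [h2]; exact h p hp X Y
  ext X Y
  refine (inCoordinates_apply_eq₂ (E₃ := Bundle.Trivial M ℝ) hb hb (Set.mem_univ p)).trans ?_
  have h4 (Z : E) : T.continuousLinearMapAt ℝ p (T.symm p Z) = Z := by
    rw [← T.symmL_apply (R := ℝ) hb]
    exact T.continuousLinearMapAt_symmL (R := ℝ) hb Z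
  have h5 : val p (T.symm p X) (T.symm p Y) = G (chartAt E p₀ p) X Y := by
    rw [h3, h4, h4]
  simpa using h5

namespace OP11
open Octonion

theorem contDiff_mul_conj {n : WithTop ℕ∞} :
    ContDiff ℝ n fun p : Octonion × Octonion => p.1 * conj p.2 :=
  contDiff_mul'.comp (g := fun p : Octonion × Octonion => p.1 * p.2)
    (f := fun p : Octonion × Octonion => (p.1, conj p.2))
    (contDiff_fst.prodMk (contDiff_conj.comp contDiff_snd))

theorem contDiff_outer_one {n : WithTop ℕ∞} :
    ContDiff ℝ n fun w : OctPair => outer 1 w.1 w.2 := by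
  have h1 : ContDiff ℝ n fun w : OctPair => ‖w.1‖ ^ 2 := (contDiff_norm_sq ℝ).comp contDiff_fst
  have h2 : ContDiff ℝ n fun w : OctPair => ‖w.2‖ ^ 2 := (contDiff_norm_sq ℝ).comp contDiff_snd
  have h3 : ContDiff ℝ n fun w : OctPair => conj w.1 := contDiff_conj.comp contDiff_fst
  have h4 : ContDiff ℝ n fun w : OctPair => conj w.2 := contDiff_conj.comp contDiff_snd
  simp only [outer, one_mul']
  exact contDiff_const.prodMk <| h1.prodMk <| h2.prodMk <| h3.prodMk <|
    contDiff_mul_conj.prodMk h4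

theorem contDiffAt_param {n : WithTop ℕ∞} {w : OctPair} (h : w ∈ target) :
    ContDiffAt ℝ n param w := by
  have h1 : ContDiff ℝ n fun w : OctPair => outer 1 w.1 w.2 := contDiff_outer_one
  have h2 : ContDiff ℝ n fun w : OctPair => trace (outer 1 w.1 w.2) :=
    trace.toContinuousLinearMap.contDiff.comp h1
  refine (h2.contDiffAt.inv ?_).smul h1.contDiffAt
  rw [trace_outer_one]; exact ne_of_gt h

theorem chart₁_mem_atlas : chart₁ ∈ atlas OctPair OP11 := Or.inl rfl
theorem chart₂_mem_atlas : chart₂ ∈ atlas OctPair OP11 := Or.inr rfl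

theorem eventually_emb_eq_of_mem_D₁ {p : OP11} (h : p ∈ D₁) : emb =ᶠ[nhds p] param ∘ chart₁ := by
  filter_upwards [isOpen_D₁.mem_nhds h] with q hq using emb_eq_of_mem_D₁ hq
theorem eventually_emb_eq_of_mem_D₂ {p : OP11} (h : p ∈ D₂) :
    emb =ᶠ[nhds p] (swapHerm.toContinuousLinearMap ∘ param) ∘ chart₂ := by
  filter_upwards [isOpen_D₂.mem_nhds h] with q hq using emb_eq_of_mem_D₂ hq

theorem contDiffAt_swapHerm_param {n : WithTop ℕ∞} {w : OctPair} (h : w ∈ target) :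
    ContDiffAt ℝ n (swapHerm.toContinuousLinearMap ∘ param) w :=
  swapHerm.toContinuousLinearMap.contDiff.contDiffAt.comp w (contDiffAt_param h)

theorem contMDiff_emb : ContMDiff 𝓘(ℝ, OctPair) 𝓘(ℝ, Herm) ∞ emb := by
  intro p
  rcases mem_D₁_or_D₂ p with h | h
  · refine ContMDiffAt.congr_of_eventuallyEq ?_ (eventually_emb_eq_of_mem_D₁ h)
    exact (contDiffAt_param (chart₁.map_source h)).contMDiffAt.comp p
      (contMDiffAt_of_mem_maximalAtlas
        (IsManifold.subset_maximalAtlas chart₁_mem_atlas) h)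
  · refine ContMDiffAt.congr_of_eventuallyEq ?_ (eventually_emb_eq_of_mem_D₂ h)
    exact (contDiffAt_swapHerm_param (chart₂.map_source h)).contMDiffAt.comp p
      (contMDiffAt_of_mem_maximalAtlas
        (IsManifold.subset_maximalAtlas chart₂_mem_atlas) h)

theorem mfderiv_emb_of_mem_D₁ {p : OP11} (h : p ∈ D₁) (X : TangentSpace 𝓘(ℝ, OctPair) p) :
    mfderiv 𝓘(ℝ, OctPair) 𝓘(ℝ, Herm) emb p X =
      fderiv ℝ param (φ₁ p) (mfderiv 𝓘(ℝ, OctPair) 𝓘(ℝ, OctPair) φ₁ p X) := by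
  have hw : φ₁ p ∈ target := chart₁.map_source h
  have h1 := mfderiv_comp p (I' := 𝓘(ℝ, OctPair)) (g := param) (f := chart₁)
    ((contDiffAt_param (n := 1) hw).differentiableAt one_ne_zero).mdifferentiableAt
    (mdifferentiableAt_atlas chart₁_mem_atlas h)
  rw [(eventually_emb_eq_of_mem_D₁ h).mfderiv_eq, h1, mfderiv_eq_fderiv]
  rfl

theorem mfderiv_emb_of_mem_D₂ {p : OP11} (h : p ∈ D₂) (X : TangentSpace 𝓘(ℝ, OctPair) p) :
    mfderiv 𝓘(ℝ, OctPair) 𝓘(ℝ, Herm) emb p X =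
      swapHerm (fderiv ℝ param (φ₂ p) (mfderiv 𝓘(ℝ, OctPair) 𝓘(ℝ, OctPair) φ₂ p X)) := by
  have hw : φ₂ p ∈ target := chart₂.map_source h
  have h1 := mfderiv_comp p (I' := 𝓘(ℝ, OctPair))
    (g := swapHerm.toContinuousLinearMap ∘ param) (f := chart₂)
    ((contDiffAt_swapHerm_param (n := 1) hw).differentiableAt one_ne_zero).mdifferentiableAt
    (mdifferentiableAt_atlas chart₂_mem_atlas h)
  have h2 : fderiv ℝ (swapHerm.toContinuousLinearMap ∘ param) (φ₂ p) =
      swapHerm.toContinuousLinearMap.comp (fderiv ℝ param (φ₂ p)) := by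
    rw [fderiv_comp _ swapHerm.toContinuousLinearMap.differentiableAt
      ((contDiffAt_param (n := 1) hw).differentiableAt one_ne_zero),
      ContinuousLinearMap.fderiv]
  rw [(eventually_emb_eq_of_mem_D₂ h).mfderiv_eq, h1, mfderiv_eq_fderiv]
  change fderiv ℝ (swapHerm.toContinuousLinearMap ∘ param) (φ₂ p) _ = _
  rw [h2]
  rfl

/-! ### The metric in coordinates -/

/-- The metric in coordinates: half the pullback of the trace form. -/
def coordForm (w : OctPair) : OctPair →L[ℝ] OctPair →L[ℝ] ℝ :=
  (2 : ℝ)⁻¹ • traceForm.bilinearComp (fderiv ℝ param w) (fderiv ℝ param w)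

theorem coordForm_apply (w ξ η : OctPair) :
    coordForm w ξ η = 2⁻¹ * traceForm (fderiv ℝ param w ξ) (fderiv ℝ param w η) := rfl

theorem contDiffAt_coordForm {w : OctPair} (h : w ∈ target) : ContDiffAt ℝ ∞ coordForm w := by
  have h1 : ContDiffAt ℝ ∞ (fderiv ℝ param) w :=
    (contDiffAt_param (n := ∞) h).fderiv_right (by simp)
  -- The derivative is inserted one slot at a time: compose, flip, compose, flip back.
  have h2 : ContDiffAt ℝ ∞ (fun w => (traceForm.comp (fderiv ℝ param w)).flip) w :=
    (ContinuousLinearMap.flipₗᵢ ℝ OctPair Herm ℝ).contDiff.contDiffAt.comp w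
      (contDiffAt_const.clm_comp h1)
  have h3 : ContDiffAt ℝ ∞
      (fun w => ((traceForm.comp (fderiv ℝ param w)).flip.comp (fderiv ℝ param w)).flip) w :=
    (ContinuousLinearMap.flipₗᵢ ℝ OctPair OctPair ℝ).contDiff.contDiffAt.comp w
      (h2.clm_comp h1)
  exact h3.const_smul (2 : ℝ)⁻¹

/-- The derivative of `w ↦ outer 1 w.1 w.2` at `w` in the direction `ξ`. -/
def outerDeriv (w ξ : OctPair) : Herm :=
  (0, 2 * inner ℝ w.1 ξ.1, 2 * inner ℝ w.2 ξ.2, conj ξ.1, ξ.1 * conj w.2 + w.1 * conj ξ.2,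
    conj ξ.2)

/-- v v* is quadratic in v, so along a line it is an exact polynomial of degree two in s, and the
derivative is its linear coefficient. -/
theorem hasDerivAt_outer_one (w ξ : OctPair) :
    HasDerivAt (fun s : ℝ => outer 1 (w + s • ξ).1 (w + s • ξ).2) (outerDeriv w ξ) 0 := by
  have h : (fun s : ℝ => outer 1 (w + s • ξ).1 (w + s • ξ).2) = fun s : ℝ =>
      outer 1 w.1 w.2 + s • outerDeriv w ξ +
        s ^ 2 • ((0, ‖ξ.1‖ ^ 2, ‖ξ.2‖ ^ 2, 0, ξ.1 * conj ξ.2, 0) : Herm) := by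
    funext s
    simp only [outer, outerDeriv, Prod.fst_add, Prod.snd_add, Prod.smul_fst, Prod.smul_snd,
      norm_add_sq_real, conj_add, conj_smul, mul_add', add_mul', smul_mul', mul_smul', norm_smul,
      mul_pow, Real.norm_eq_abs, sq_abs, real_inner_smul_right, one_mul', Prod.mk_add_mk,
      Prod.smul_mk, smul_eq_mul, Prod.mk.injEq, mul_zero, add_zero, smul_zero, true_and, and_true]
    exact ⟨by ring, by ring, by module⟩
  rw [h]
  have h1 := (((hasDerivAt_id (0 : ℝ)).smul_const (outerDeriv w ξ)).const_add
    (outer 1 w.1 w.2)).add (((hasDerivAt_id (0 : ℝ)).pow 2).smul_const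
      ((0, ‖ξ.1‖ ^ 2, ‖ξ.2‖ ^ 2, 0, ξ.1 * conj ξ.2, 0) : Herm))
  simpa using! h1

/-- The quotient rule for v v* / (v* v) along the line w + sξ, compared with the chain rule by
uniqueness of derivatives. -/
theorem fderiv_param {w : OctPair} (h : w ∈ target) (ξ : OctPair) :
    fderiv ℝ param w ξ = (trace (outer 1 w.1 w.2))⁻¹ • outerDeriv w ξ -
      (trace (outerDeriv w ξ) / trace (outer 1 w.1 w.2) ^ 2) • outer 1 w.1 w.2 := by
  have h0 : trace (outer 1 w.1 w.2) ≠ 0 := by rw [trace_outer_one]; exact ne_of_gt h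
  have h1 : HasDerivAt (fun s : ℝ => param (w + s • ξ)) (fderiv ℝ param w ξ) 0 := by
    have hp : HasFDerivAt param (fderiv ℝ param w) (w + (0 : ℝ) • ξ) := by
      rw [zero_smul, add_zero]
      exact ((contDiffAt_param (n := 1) h).differentiableAt one_ne_zero).hasFDerivAt
    have hl : HasDerivAt (fun s : ℝ => w + s • ξ) ξ 0 := by
      simpa using ((hasDerivAt_id (0 : ℝ)).smul_const ξ).const_add w
    exact hp.comp_hasDerivAt (0 : ℝ) hl
  have h2 := hasDerivAt_outer_one w ξ
  have h3 : HasDerivAt (fun s : ℝ => trace (outer 1 (w + s • ξ).1 (w + s • ξ).2))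
      (trace (outerDeriv w ξ)) 0 :=
    trace.toContinuousLinearMap.hasFDerivAt.comp_hasDerivAt (0 : ℝ) h2
  have h4 := (h3.inv (by simpa using h0)).smul h2
  rw [h1.unique h4]
  simp only [Pi.inv_apply, zero_smul, add_zero, neg_div, neg_smul, sub_eq_add_neg]

theorem traceForm_outer_one (w : OctPair) :
    traceForm (outer 1 w.1 w.2) (outer 1 w.1 w.2) = trace (outer 1 w.1 w.2) ^ 2 := by
  rw [trace_outer]
  simp only [traceForm_self, outer, norm_sq_mul, norm_conj, norm_one']
  ring

theorem trace_outerDeriv (w ξ : OctPair) :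
    trace (outerDeriv w ξ) = 2 * inner ℝ w.1 ξ.1 - 2 * inner ℝ w.2 ξ.2 := by
  simp [trace_apply, outerDeriv]

/-- Half the derivative of `traceForm_outer_one` in the direction ξ. -/
theorem traceForm_outer_outerDeriv (w ξ : OctPair) :
    traceForm (outer 1 w.1 w.2) (outerDeriv w ξ) =
      trace (outer 1 w.1 w.2) * trace (outerDeriv w ξ) := by
  rw [trace_outerDeriv, trace_outer_one]
  simp only [traceForm_apply, outer, outerDeriv, one_mul', inner_conj_conj, inner_add_right,
    inner_mul_mul_left, inner_mul_mul_right, norm_conj]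
  ring

theorem traceForm_outerDeriv (w ξ : OctPair) :
    traceForm (outerDeriv w ξ) (outerDeriv w ξ) = trace (outerDeriv w ξ) ^ 2 +
      2 * (‖ξ.1‖ ^ 2 * (1 - ‖w.2‖ ^ 2) - ‖ξ.2‖ ^ 2 * (1 + ‖w.1‖ ^ 2)
        + 2 * re ((w.1 * conj w.2) * (ξ.2 * conj ξ.1))) := by
  have h1 : re ((w.1 * conj w.2) * (ξ.2 * conj ξ.1)) =
      inner ℝ (ξ.1 * conj ξ.2) (w.1 * conj w.2) := by
    rw [re_mul_eq_inner, conj_mul, conj_conj, real_inner_comm]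
  -- The cross term ⟨du v̄, u dv̄⟩ is 2⟨u, du⟩⟨v, dv⟩ - ⟨du dv̄, u v̄⟩. The first part completes the
  -- square of the trace, and the second is the Re term of ds².
  have h2 := inner_mul_mul_add ξ.1 w.1 (conj w.2) (conj ξ.2)
  rw [inner_conj_conj, real_inner_comm w.1 ξ.1] at h2
  rw [trace_outerDeriv, h1, traceForm_self]
  simp only [outerDeriv, norm_conj, norm_add_sq_real, norm_sq_mul]
  linear_combination (-4) * h2

/-- `ds²` is half the pullback of the trace form under the embedding. -/
theorem coordForm_self {w : OctPair} (h : w ∈ target) (ξ : OctPair) :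
    coordForm w ξ ξ = dsSq w ξ := by
  have h0 : trace (outer 1 w.1 w.2) ≠ 0 := by rw [trace_outer_one]; exact ne_of_gt h
  have h1 := traceForm_outer_one w
  have h2 := traceForm_outer_outerDeriv w ξ
  have h3 := traceForm_comm (outerDeriv w ξ) (outer 1 w.1 w.2)
  rw [coordForm_apply, fderiv_param h, dsSq, ← trace_outer_one]
  -- Write O = v v*, T = tr O. Then dP = dO/T - (dT/T²) O, and with ⟨O, O⟩ = T² and ⟨O, dO⟩ = T dT
  -- one gets ⟨dP, dP⟩ = (⟨dO, dO⟩ - dT²)/T²; the dT² inside ⟨dO, dO⟩ cancels.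
  simp only [map_sub, map_smul, sub_apply, smul_apply, smul_eq_mul, h3, h2, h1,
    traceForm_outerDeriv]
  field_simp
  ring

/-! ### Nondegeneracy and signature by completing the square -/

/-- The linear map whose graph is the orthogonal complement of the `v`-direction. -/
def shear (w : OctPair) : Octonion →ₗ[ℝ] Octonion where
  toFun x := (1 + ‖w.1‖ ^ 2)⁻¹ • ((w.2 * conj w.1) * x)
  map_add' x y := by rw [mul_add', smul_add]
  map_smul' r x := by rw [mul_smul', smul_comm, RingHom.id_apply]

theorem shear_apply (w : OctPair) (x : Octonion) :
    shear w x = (1 + ‖w.1‖ ^ 2)⁻¹ • ((w.2 * conj w.1) * x) := rfl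

/-- On the graph dv = (1 + |u|²)⁻¹ (v ū) du the form is positive definite. The product ((v ū) x) x̄
collapses to |x|² v ū, whose product with u v̄ is real. -/
theorem dsSq_shear {w : OctPair} (h : w ∈ target) (x : Octonion) :
    dsSq w (x, shear w x) =
      ‖x‖ ^ 2 / ((1 + ‖w.1‖ ^ 2) * (1 + ‖w.1‖ ^ 2 - ‖w.2‖ ^ 2)) := by
  have hN : 1 + ‖w.1‖ ^ 2 - ‖w.2‖ ^ 2 ≠ 0 := ne_of_gt h
  have hC : 1 + ‖w.1‖ ^ 2 ≠ 0 := by positivity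
  have h1 : re ((w.1 * conj w.2) * (((w.2 * conj w.1) * x) * conj x)) =
      ‖w.1‖ ^ 2 * ‖w.2‖ ^ 2 * ‖x‖ ^ 2 := by
    have e : w.2 * conj w.1 = conj (w.1 * conj w.2) := by rw [conj_mul, conj_conj]
    rw [mul_mul_conj, mul_smul', e, mul_conj_self]
    simp only [re, fst_smul, fst_one, Quaternion.re_smul, Quaternion.re_one, smul_eq_mul,
      norm_sq_mul, norm_conj]
    ring
  simp only [dsSq, shear_apply, smul_mul', mul_smul', norm_smul, mul_pow, norm_sq_mul, norm_conj,
    norm_inv, Real.norm_eq_abs, sq_abs, inv_pow]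
  have h2 (r : ℝ) (a : Octonion) : re (r • a) = r * re a := rfl
  rw [h2, h1]
  field_simp
  ring

theorem dsSq_zero_left (w : OctPair) (y : Octonion) :
    dsSq w (0, y) = -(‖y‖ ^ 2 * (1 + ‖w.1‖ ^ 2) / (1 + ‖w.1‖ ^ 2 - ‖w.2‖ ^ 2) ^ 2) := by
  simp only [dsSq, conj_zero, mul_zero', norm_zero, re, fst_zero, Quaternion.re_zero]
  ring

theorem coordForm_comm (w ξ η : OctPair) : coordForm w ξ η = coordForm w η ξ := by
  rw [coordForm_apply, coordForm_apply, traceForm_comm]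

theorem coordForm_nondegenerate {w : OctPair} (h : w ∈ target) (ξ : OctPair)
    (hξ : ∀ η, coordForm w ξ η = 0) : ξ = 0 := by
  have hN : 0 < 1 + ‖w.1‖ ^ 2 - ‖w.2‖ ^ 2 := h
  obtain ⟨x, y⟩ := ξ
  -- The test vector is the mirror image of (x, y) in the graph of S = `shear w`: writing y = Sx +
  -- d, it is (x, Sx - d). The sum of the two vectors lies on the graph, where the form is positive,
  -- and their difference in the v-direction, where it is negative. By polarization their pairing is
  -- a sum of two nonnegative terms, which vanish only if x = 0 and d = 0.
  have h1 := coordForm_self h ((x, y) + (x, (2 : ℝ) • shear w x - y))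
  have h2 := coordForm_self h ((x, y) - (x, (2 : ℝ) • shear w x - y))
  have e1 : (x, y) + (x, (2 : ℝ) • shear w x - y) = ((2 : ℝ) • x, shear w ((2 : ℝ) • x)) := by
    rw [Prod.mk_add_mk, map_smul, two_smul ℝ x]; congr 1; abel
  have e2 : (x, y) - (x, (2 : ℝ) • shear w x - y) = ((0 : Octonion), (2 : ℝ) • (y - shear w x)) := by
    rw [Prod.mk_sub_mk, sub_self]; congr 1; module
  have h3 : coordForm w (x, y) (x, (2 : ℝ) • shear w x - y) =
      ‖x‖ ^ 2 / ((1 + ‖w.1‖ ^ 2) * (1 + ‖w.1‖ ^ 2 - ‖w.2‖ ^ 2)) +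
        ‖y - shear w x‖ ^ 2 * (1 + ‖w.1‖ ^ 2) / (1 + ‖w.1‖ ^ 2 - ‖w.2‖ ^ 2) ^ 2 := by
    have h5 := coordForm_comm w (x, (2 : ℝ) • shear w x - y) (x, y)
    have h6 : dsSq w ((x, y) + (x, (2 : ℝ) • shear w x - y)) =
        4 * (‖x‖ ^ 2 / ((1 + ‖w.1‖ ^ 2) * (1 + ‖w.1‖ ^ 2 - ‖w.2‖ ^ 2))) := by
      rw [e1, dsSq_shear h, norm_smul, Real.norm_ofNat]; ring
    have h7 : dsSq w ((x, y) - (x, (2 : ℝ) • shear w x - y)) =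
        -4 * (‖y - shear w x‖ ^ 2 * (1 + ‖w.1‖ ^ 2) / (1 + ‖w.1‖ ^ 2 - ‖w.2‖ ^ 2) ^ 2) := by
      rw [e2, dsSq_zero_left, norm_smul, Real.norm_ofNat]; ring
    rw [h6] at h1
    rw [h7] at h2
    simp only [map_add, map_sub, add_apply, sub_apply, h5] at h1 h2
    linarith
  rw [hξ] at h3
  have h4 : 0 ≤ ‖x‖ ^ 2 / ((1 + ‖w.1‖ ^ 2) * (1 + ‖w.1‖ ^ 2 - ‖w.2‖ ^ 2)) := by positivity
  have h5 : 0 ≤ ‖y - shear w x‖ ^ 2 * (1 + ‖w.1‖ ^ 2) / (1 + ‖w.1‖ ^ 2 - ‖w.2‖ ^ 2) ^ 2 := by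
    positivity
  have hC : 1 + ‖w.1‖ ^ 2 ≠ 0 := by positivity
  have h6 : x = 0 := by
    have : ‖x‖ ^ 2 / ((1 + ‖w.1‖ ^ 2) * (1 + ‖w.1‖ ^ 2 - ‖w.2‖ ^ 2)) = 0 := by linarith
    simpa [hC, hN.ne'] using this
  have h7 : y - shear w x = 0 := by
    have : ‖y - shear w x‖ ^ 2 * (1 + ‖w.1‖ ^ 2) / (1 + ‖w.1‖ ^ 2 - ‖w.2‖ ^ 2) ^ 2 = 0 := by
      linarith
    simpa [hC, hN.ne'] using this
  rw [h6, map_zero, sub_zero] at h7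
  rw [h6, h7]; rfl

/-- A quadratic form that is `ds²` in linear coordinates has signature `(8, 8)`. -/
theorem sigPos_eq_and_sigNeg_eq {W : Type*} [AddCommGroup W] [Module ℝ W]
    (Q : QuadraticForm ℝ W) (e : W ≃ₗ[ℝ] OctPair) {w : OctPair} (h : w ∈ target)
    (hQ : ∀ X, Q X = dsSq w (e X)) : _root_.sigPos Q = 8 ∧ _root_.sigNeg Q = 8 := by
  have hN : 0 < 1 + ‖w.1‖ ^ 2 - ‖w.2‖ ^ 2 := h
  have : FiniteDimensional ℝ W := e.symm.finiteDimensional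
  let f : Octonion →ₗ[ℝ] W := e.symm.toLinearMap ∘ₗ (LinearMap.id.prod (shear w))
  let f' : Octonion →ₗ[ℝ] W := e.symm.toLinearMap ∘ₗ (LinearMap.inr ℝ Octonion Octonion)
  have hf : Function.Injective f := fun x y hxy => congrArg Prod.fst (e.symm.injective hxy)
  have hf' : Function.Injective f' := fun x y hxy => congrArg Prod.snd (e.symm.injective hxy)
  have h1 : 8 ≤ _root_.sigPos Q := by
    rw [← Octonion.finrank_eq, ← LinearMap.finrank_range_of_inj hf]
    refine le_sigPos_of_posDef Q ?_
    rintro ⟨_, x, rfl⟩ hx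
    have hx0 : x ≠ 0 := by rintro rfl; exact hx (by simp)
    have : Q (f x) = _ := (hQ (f x)).trans
      ((congrArg _ (e.apply_symm_apply (x, shear w x))).trans (dsSq_shear h x))
    have hp : 0 < ‖x‖ := norm_pos_iff.2 hx0
    change 0 < Q (f x)
    rw [this]
    positivity
  have h2 : 8 ≤ _root_.sigNeg Q := by
    rw [← Octonion.finrank_eq, ← LinearMap.finrank_range_of_inj hf']
    refine le_sigNeg_of_negDef Q ?_
    rintro ⟨_, x, rfl⟩ hx
    have hx0 : x ≠ 0 := by rintro rfl; exact hx (by simp)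
    have : Q (f' x) = _ := (hQ (f' x)).trans
      ((congrArg _ (e.apply_symm_apply (0, x))).trans (dsSq_zero_left w x))
    have hp : 0 < ‖x‖ := norm_pos_iff.2 hx0
    change 0 < -Q (f' x)
    rw [this, neg_neg]
    positivity
  -- Definite subspaces of dimension 8 of both signs already exhaust dimension 16, so both lower
  -- bounds are sharp.
  have h3 := QuadraticForm.sigPos_add_sigNeg_add_radical (Q := Q)
  have h4 : Module.finrank ℝ W = 16 := by
    rw [e.finrank_eq, Module.finrank_prod, Octonion.finrank_eq]
  omega

/-! ### The global metric -/

/-- The differential of the embedding. -/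
def embDeriv (p : OP11) : OctPair →L[ℝ] Herm := mfderiv 𝓘(ℝ, OctPair) 𝓘(ℝ, Herm) emb p

/-- The differential of a map `OP11 → 𝕆²`. -/
def coordDeriv (φ : OP11 → OctPair) (p : OP11) : OctPair →L[ℝ] OctPair :=
  mfderiv 𝓘(ℝ, OctPair) 𝓘(ℝ, OctPair) φ p

/-- Half the pullback of the trace form under the embedding. -/
def metricVal (p : OP11) : OctPair →L[ℝ] OctPair →L[ℝ] ℝ :=
  (2 : ℝ)⁻¹ • traceForm.bilinearComp (embDeriv p) (embDeriv p)

theorem metricVal_apply (p : OP11) (X Y : OctPair) :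
    metricVal p X Y = 2⁻¹ * traceForm (embDeriv p X) (embDeriv p Y) := rfl

theorem metricVal_of_mem_D₁ {p : OP11} (h : p ∈ D₁) (X Y : OctPair) :
    metricVal p X Y = coordForm (φ₁ p) (coordDeriv φ₁ p X) (coordDeriv φ₁ p Y) := by
  have h1 (Z : OctPair) : embDeriv p Z = fderiv ℝ param (φ₁ p) (coordDeriv φ₁ p Z) :=
    mfderiv_emb_of_mem_D₁ h Z
  rw [metricVal_apply, h1, h1, coordForm_apply]

theorem metricVal_of_mem_D₂ {p : OP11} (h : p ∈ D₂) (X Y : OctPair) :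
    metricVal p X Y = coordForm (φ₂ p) (coordDeriv φ₂ p X) (coordDeriv φ₂ p Y) := by
  have h1 (Z : OctPair) : embDeriv p Z = swapHerm (fderiv ℝ param (φ₂ p) (coordDeriv φ₂ p Z)) :=
    mfderiv_emb_of_mem_D₂ h Z
  rw [metricVal_apply, h1, h1, isReflection_swapHerm.map_traceForm, coordForm_apply]

/-- Around every point there is a chart in which the metric is `coordForm`. -/
theorem exists_chart (p : OP11) : ∃ e ∈ atlas OctPair OP11, p ∈ e.source ∧
    ∀ q ∈ e.source, e q ∈ target ∧ ∀ X Y : OctPair,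
      metricVal q X Y = coordForm (e q) (coordDeriv e q X) (coordDeriv e q Y) := by
  rcases mem_D₁_or_D₂ p with h | h
  · exact ⟨chart₁, chart₁_mem_atlas, h, fun q hq =>
      ⟨chart₁.map_source hq, metricVal_of_mem_D₁ hq⟩⟩
  · exact ⟨chart₂, chart₂_mem_atlas, h, fun q hq =>
      ⟨chart₂.map_source hq, metricVal_of_mem_D₂ hq⟩⟩

/-- The metric of the indefinite octonionic projective plane. -/
def metric : SemiRiemannianMetric OctPair OP11 where
  val := metricVal
  symm p X Y := congrArg (2⁻¹ * ·) (traceForm_comm (embDeriv p X) (embDeriv p Y))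
  nondegenerate p X h := by
    obtain ⟨e, he, hp, hm⟩ := exists_chart p
    have hd := mdifferentiable_of_mem_atlas (I := 𝓘(ℝ, OctPair)) he
    apply hd.mfderiv_injective hp
    rw [map_zero]
    refine coordForm_nondegenerate (hm p hp).1 _ fun η => ?_
    obtain ⟨Y, hY⟩ := hd.mfderiv_surjective hp η
    rw [← hY]
    exact ((hm p hp).2 X Y).symm.trans (h Y)
  contMDiff p := by
    by_cases h : p ∈ D₁
    · have hc : chartAt OctPair p = chart₁ := if_pos h
      refine contMDiffAt_bilin_of_chart _ p coordForm ?_ ?_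
      · rw [hc]; exact contDiffAt_coordForm (chart₁.map_source h)
      · rw [hc]; exact fun q hq => metricVal_of_mem_D₁ hq
    · have hc : chartAt OctPair p = chart₂ := if_neg h
      have h' := (mem_D₁_or_D₂ p).resolve_left h
      refine contMDiffAt_bilin_of_chart _ p coordForm ?_ ?_
      · rw [hc]; exact contDiffAt_coordForm (chart₂.map_source h')
      · rw [hc]; exact fun q hq => metricVal_of_mem_D₂ hq

theorem isGivenByDsSq_metric : IsGivenByDsSq metric :=
  ⟨fun _ hp X => (metricVal_of_mem_D₁ hp X X).trans (coordForm_self (chart₁.map_source hp) _),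
    fun _ hp X => (metricVal_of_mem_D₂ hp X X).trans (coordForm_self (chart₂.map_source hp) _)⟩

/-- The two patches cover the plane, so the quadratic forms agree everywhere; polarization gives
equality of the bilinear forms. -/
theorem eq_of_isGivenByDsSq {g g' : SemiRiemannianMetric OctPair OP11} (h : IsGivenByDsSq g)
    (h' : IsGivenByDsSq g') : g = g' := by
  have hs (p : OP11) (X : TangentSpace 𝓘(ℝ, OctPair) p) : g.val p X X = g'.val p X X := by
    rcases mem_D₁_or_D₂ p with hp | hp
    · rw [h.1 p hp, h'.1 p hp]
    · rw [h.2 p hp, h'.2 p hp]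
  have hv : g.val = g'.val := by
    funext p
    ext X Y
    have h1 := hs p (X + Y)
    simp only [map_add, add_apply, hs p X, hs p Y, g.symm p Y X, g'.symm p Y X] at h1
    linarith
  cases g; cases g'; congr

theorem hasSignature_metric : metric.HasSignature 8 8 := by
  intro p
  obtain ⟨e, he, hp, hm⟩ := exists_chart p
  have hd := mdifferentiable_of_mem_atlas (I := 𝓘(ℝ, OctPair)) he
  refine sigPos_eq_and_sigNeg_eq _ (hd.mfderiv hp).toLinearEquiv (hm p hp).1 fun X => ?_
  exact ((hm p hp).2 X X).trans (coordForm_self (hm p hp).1 _)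

/-! ### Density of the patches and uniqueness of extensions -/

/-- Near a point outside S, a chart turns the question into density of T in the model space. For the
patches, T is the locus where one coordinate is nonzero. -/
theorem dense_of_chart {S : Set OP11} {T : Set OctPair} (hT : Dense T)
    (h : ∀ p, p ∈ S ∨ ∃ e : OpenPartialHomeomorph OP11 OctPair, p ∈ e.source ∧
      ∀ w ∈ e.target, w ∈ T → e.symm w ∈ S) : Dense S := by
  intro p
  rcases h p with hp | ⟨e, hp, he⟩
  · exact subset_closure hp
  · rw [mem_closure_iff_nhds]
    intro O hO
    have h1 : e.symm ⁻¹' O ∈ nhds (e p) :=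
      (e.continuousAt_symm (e.map_source hp)).preimage_mem_nhds (by rwa [e.left_inv hp])
    have h2 := Filter.inter_mem h1 (e.open_target.mem_nhds (e.map_source hp))
    obtain ⟨w, ⟨hw, hw'⟩, hwT⟩ := mem_closure_iff_nhds.1 (hT (e p)) _ h2
    exact ⟨e.symm w, hw, he w hw' hwT⟩

theorem dense_compl_zero : Dense ({0}ᶜ : Set Octonion) := by
  have : Nontrivial Octonion := ⟨1, 0, one_ne_zero'⟩
  exact dense_compl_singleton 0

theorem dense_fst_ne_zero : Dense {w : OctPair | w.1 ≠ 0} :=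
  dense_compl_zero.preimage isOpenMap_fst
theorem dense_snd_ne_zero : Dense {w : OctPair | w.2 ≠ 0} :=
  dense_compl_zero.preimage isOpenMap_snd

theorem dense_D₁ : Dense D₁ :=
  dense_of_chart dense_fst_ne_zero fun p => (mem_D₁_or_D₂ p).imp_right fun h =>
    ⟨chart₂, h, fun w hw hw' => by
      change ψ₂ w ∈ D₁
      rw [ψ₂_of_mem hw]; exact cls_mem_D₁.2 hw'⟩

theorem dense_D₂ : Dense D₂ :=
  dense_of_chart dense_fst_ne_zero fun p => (mem_D₁_or_D₂ p).symm.imp_right fun h =>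
    ⟨chart₁, h, fun w hw hw' => by
      change ψ₁ w ∈ D₂
      rw [ψ₁_of_mem hw]; exact cls_mem_D₂.2 hw'⟩

theorem dense_D₃ : Dense D₃ :=
  dense_of_chart dense_snd_ne_zero fun p => Or.inr <| by
    rcases mem_D₁_or_D₂ p with h | h
    · exact ⟨chart₁, h, fun w hw hw' => by
        change ψ₁ w ∈ D₃
        rw [ψ₁_of_mem hw]; exact ⟨_, hw', rfl⟩⟩
    · exact ⟨chart₂, h, fun w hw hw' => by
        change ψ₂ w ∈ D₃
        rw [ψ₂_of_mem hw]; exact ⟨_, hw', rfl⟩⟩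

theorem lineProj_one_right_coords {x y : Octonion} (h : trace (outer x y 1) ≠ 0) :
    ((lineProj x y 1).2.2.1⁻¹ • (lineProj x y 1).2.2.2.2.2,
      (lineProj x y 1).2.2.1⁻¹ • (lineProj x y 1).2.2.2.2.1) = (x, y) := by
  unfold lineProj
  generalize trace (outer x y 1) = t at h
  simp [outer, norm_one', conj_one, mul_one', smul_smul, mul_inv_cancel₀ h]

theorem injOn_φ₃ : Set.InjOn φ₃ D₃ := by
  intro p hp q hq h
  apply emb_injective
  rw [emb_eq_of_mem_D₃ hp, emb_eq_of_mem_D₃ hq, h]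

theorem perm_eq_of_extends {D : Set OP11} {φ : OP11 → OctPair} {f : OctPair → OctPair}
    (hD : Dense D) (hφ : Set.InjOn φ D) {F F' : Equiv.Perm OP11} (hF : Continuous F)
    (hF' : Continuous F') (h : Extends F D φ f) (h' : Extends F' D φ f) : F' = F := by
  refine Equiv.coe_fn_injective (hF'.ext_on hD hF fun p hp => ?_)
  exact hφ (h' p hp).1 (h p hp).1 ((h' p hp).2.trans (h p hp).2.symm)

/-! ### Isometries induced by linear reflections -/

theorem continuous_emb : Continuous emb := contMDiff_emb.continuous

/-- `coord` is a smooth left inverse of the embedding in a chart, so near p the map f equals the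
inverse chart composed with coord ∘ A ∘ L ∘ emb. Here A is the identity for the first chart and the
swap for the second. -/
theorem contMDiff_of_emb {L : Herm →ₗ[ℝ] Herm} {f : OP11 → OP11}
    (hf : ∀ p, emb (f p) = L (emb p)) : ContMDiff 𝓘(ℝ, OctPair) 𝓘(ℝ, OctPair) ∞ f := by
  have key (A : Herm →ₗ[ℝ] Herm) (e : OpenPartialHomeomorph OP11 OctPair)
      (he : e ∈ atlas OctPair OP11) (h1 : ∀ q ∈ e.source, coord (A (emb q)) = e q)
      (h2 : ∀ q, q ∈ e.source ↔ (A (emb q)).1 ≠ 0) (p : OP11) (hp : f p ∈ e.source) :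
      ContMDiffAt 𝓘(ℝ, OctPair) 𝓘(ℝ, OctPair) ∞ f p := by
    let B : Herm →L[ℝ] Herm := (A ∘ₗ L).toContinuousLinearMap
    have hB (q : OP11) : B (emb q) = A (emb (f q)) := by rw [hf]; rfl
    have hcont : Continuous fun q => (B (emb q)).1 :=
      continuous_fst.comp (B.continuous.comp continuous_emb)
    have hne : (B (emb p)).1 ≠ 0 := by rw [hB]; exact (h2 _).1 hp
    have h3 : ContMDiffAt 𝓘(ℝ, OctPair) 𝓘(ℝ, OctPair) ∞ (fun q => coord (B (emb q))) p :=
      ((contDiffAt_coord hne).comp (emb p) B.contDiff.contDiffAt).contMDiffAt.comp p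
        (contMDiff_emb p)
    have h4 : ContMDiffAt 𝓘(ℝ, OctPair) 𝓘(ℝ, OctPair) ∞ e.symm (coord (B (emb p))) := by
      rw [hB, h1 _ hp]
      exact contMDiffAt_symm_of_mem_maximalAtlas (IsManifold.subset_maximalAtlas he)
        (e.map_source hp)
    refine (h4.comp p h3).congr_of_eventuallyEq ?_
    filter_upwards [hcont.continuousAt.eventually_ne hne] with q hq
    have hq' : f q ∈ e.source := by rw [h2, ← hB]; exact hq
    change f q = e.symm (coord (B (emb q)))
    rw [hB, h1 _ hq', e.left_inv hq']
  intro p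
  rcases mem_D₁_or_D₂ (f p) with h | h
  · exact key LinearMap.id chart₁ chart₁_mem_atlas (fun q hq => coord_emb hq)
      (fun q => mem_D₁_iff) p h
  · exact key swapHerm chart₂ chart₂_mem_atlas (fun q hq => coord_swapHerm_emb hq)
      (fun q => mem_D₂_iff) p h

/-- A linear reflection that preserves the image of the embedding induces an involutive
isometry. -/
theorem IsReflection.exists_isometry {L : Herm →ₗ[ℝ] Herm} (hL : IsReflection L) {D : Set OP11}
    (hD : Dense D) (h : ∀ p ∈ D, L (emb p) ∈ Set.range emb) :
    ∃ F : Equiv.Perm OP11, (∀ p, emb (F p) = L (emb p)) ∧ metric.IsIsometry F ∧ F * F = 1 := by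
  -- The points that L keeps in the image form a closed set containing the dense set D.
  have hr (p : OP11) : L (emb p) ∈ Set.range emb := by
    have hc : IsClosed {p : OP11 | L (emb p) ∈ Set.range emb} :=
      isClosed_range_emb.preimage (L.toContinuousLinearMap.continuous.comp continuous_emb)
    exact hc.closure_subset_iff.2 h (hD p)
  choose f hf using hr
  have hinv : Function.Involutive f := fun p => emb_injective (by rw [hf, hf, hL.involutive])
  have hsm := contMDiff_of_emb hf
  refine ⟨hinv.toPerm f, hf, ⟨hsm, hsm, fun p X Y => ?_⟩, Equiv.ext hinv⟩
  -- Differentiate emb ∘ f = L ∘ emb.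
  have hd (Z : OctPair) : embDeriv (f p) (mfderiv 𝓘(ℝ, OctPair) 𝓘(ℝ, OctPair) f p Z) =
      L (embDeriv p Z) := by
    have h1 := mfderiv_comp p (contMDiff_emb.mdifferentiable (by simp) (f p))
      (hsm.mdifferentiable (by simp) p)
    have h2 := mfderiv_comp p (I' := 𝓘(ℝ, Herm)) (I'' := 𝓘(ℝ, Herm))
      (g := L.toContinuousLinearMap) L.toContinuousLinearMap.differentiableAt.mdifferentiableAt
      (contMDiff_emb.mdifferentiable (by simp) p)
    have h3 : emb ∘ f = L.toContinuousLinearMap ∘ emb := funext hf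
    rw [h3, h2, mfderiv_eq_fderiv, ContinuousLinearMap.fderiv] at h1
    exact (DFunLike.congr_fun h1 Z).symm
  have key (X Y X' Y' : OctPair) (hX : embDeriv (f p) X' = L (embDeriv p X))
      (hY : embDeriv (f p) Y' = L (embDeriv p Y)) : metricVal (f p) X' Y' = metricVal p X Y := by
    rw [metricVal_apply, metricVal_apply, hX, hY, hL.map_traceForm]
  exact key X Y _ _ (hd X) (hd Y)

theorem indefRefl_mem_target {r : ℝ} {l : Octonion} (h : r ^ 2 - ‖l‖ ^ 2 = 1) {w : OctPair}
    (hw : w ∈ target) : indefRefl r l w ∈ target := by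
  have h1 := (isReflection_indefHerm h).map_trace (outer 1 w.1 w.2)
  rw [indefHerm_outer h, trace_outer_one, trace_outer_one] at h1
  exact lt_of_lt_of_eq hw h1.symm

theorem indefHerm_param {r : ℝ} {l : Octonion} (h : r ^ 2 - ‖l‖ ^ 2 = 1) (w : OctPair) :
    indefHerm r l (param w) = param (indefRefl r l w) :=
  (isReflection_indefHerm h).map_lineProj (indefHerm_outer h w.1 w.2)

/-- The conjugate of `indefHerm` by the swap of the first two coordinates. -/
def indefHerm' (r : ℝ) (l : Octonion) : Herm →ₗ[ℝ] Herm := swapHerm ∘ₗ indefHerm r l ∘ₗ swapHerm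

theorem indefHerm'_apply (r : ℝ) (l : Octonion) (X : Herm) :
    indefHerm' r l X = swapHerm (indefHerm r l (swapHerm X)) := rfl

theorem isReflection_indefHerm' {r : ℝ} {l : Octonion} (h : r ^ 2 - ‖l‖ ^ 2 = 1) :
    IsReflection (indefHerm' r l) where
  involutive X := by
    simp only [indefHerm'_apply, isReflection_swapHerm.involutive,
      (isReflection_indefHerm h).involutive]
  map_trace X := by
    simp only [indefHerm'_apply, isReflection_swapHerm.map_trace,
      (isReflection_indefHerm h).map_trace]
  map_traceForm_self X := by
    simp only [indefHerm'_apply, isReflection_swapHerm.map_traceForm_self,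
      (isReflection_indefHerm h).map_traceForm_self]

theorem exists_indefRefl₁ {r : ℝ} {l : Octonion} (h : r ^ 2 - ‖l‖ ^ 2 = 1) :
    ∃ F : Equiv.Perm OP11, (∀ p, emb (F p) = indefHerm r l (emb p)) ∧ metric.IsIsometry F ∧
      F * F = 1 ∧ Extends F D₁ φ₁ (indefRefl r l) := by
  have hp {p : OP11} (hp : p ∈ D₁) :
      indefHerm r l (emb p) = param (indefRefl r l (φ₁ p)) := by
    rw [emb_eq_of_mem_D₁ hp, indefHerm_param h]
  have ht {p : OP11} (hp : p ∈ D₁) : indefRefl r l (φ₁ p) ∈ target :=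
    indefRefl_mem_target h (chart₁.map_source hp)
  obtain ⟨F, h1, h2, h3⟩ := (isReflection_indefHerm h).exists_isometry dense_D₁
    fun p hp' => ⟨pt₁ ⟨_, ht hp'⟩, by rw [emb_pt₁, hp hp']⟩
  refine ⟨F, h1, h2, h3, fun p hp' => ?_⟩
  -- `indefHerm` fixes the first diagonal entry, whose nonvanishing defines the patch. The other two
  -- reflections fix the second and the third entry respectively.
  have hF : F p ∈ D₁ := by
    rw [mem_D₁_iff, h1]; exact mem_D₁_iff.1 hp'
  exact ⟨hF, by rw [← coord_emb hF, h1, hp hp', coord_param (ht hp')]⟩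

theorem exists_indefRefl₂ {r : ℝ} {l : Octonion} (h : r ^ 2 - ‖l‖ ^ 2 = 1) :
    ∃ F : Equiv.Perm OP11, (∀ p, emb (F p) = indefHerm' r l (emb p)) ∧ metric.IsIsometry F ∧
      F * F = 1 ∧ Extends F D₂ φ₂ (indefRefl r l) := by
  have hp {p : OP11} (hp : p ∈ D₂) :
      indefHerm' r l (emb p) = swapHerm (param (indefRefl r l (φ₂ p))) := by
    rw [emb_eq_of_mem_D₂ hp, indefHerm'_apply, isReflection_swapHerm.involutive,
      indefHerm_param h]
  have ht {p : OP11} (hp : p ∈ D₂) : indefRefl r l (φ₂ p) ∈ target :=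
    indefRefl_mem_target h (chart₂.map_source hp)
  obtain ⟨F, h1, h2, h3⟩ := (isReflection_indefHerm' h).exists_isometry dense_D₂
    fun p hp' => ⟨pt₂ ⟨_, ht hp'⟩, by rw [emb_pt₂, hp hp']⟩
  refine ⟨F, h1, h2, h3, fun p hp' => ?_⟩
  have hF : F p ∈ D₂ := by
    rw [mem_D₂_iff, h1]; exact mem_D₂_iff.1 hp'
  exact ⟨hF, by rw [← coord_swapHerm_emb hF, h1, hp hp', isReflection_swapHerm.involutive,
    coord_param (ht hp')]⟩

theorem exists_euclRefl {r : ℝ} {l : Octonion} (h : r ^ 2 + ‖l‖ ^ 2 = 1) :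
    ∃ F : Equiv.Perm OP11, (∀ p, emb (F p) = euclHerm r l (emb p)) ∧ metric.IsIsometry F ∧
      F * F = 1 ∧ Extends F D₃ φ₃ (euclRefl r l) := by
  have hp {p : OP11} (hp : p ∈ D₃) : euclHerm r l (emb p) =
      lineProj (euclRefl r l (φ₃ p)).1 (euclRefl r l (φ₃ p)).2 1 := by
    rw [emb_eq_of_mem_D₃ hp]
    exact (isReflection_euclHerm h).map_lineProj (euclHerm_outer h _ _)
  have ht {p : OP11} (hp : p ∈ D₃) :
      0 < trace (outer (euclRefl r l (φ₃ p)).1 (euclRefl r l (φ₃ p)).2 1) := by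
    rw [← Prod.mk.eta (p := φ₃ p), ← euclHerm_outer h, (isReflection_euclHerm h).map_trace]
    exact trace_outer_φ₃_pos hp
  obtain ⟨F, h1, h2, h3⟩ := (isReflection_euclHerm h).exists_isometry dense_D₃ fun p hp' => by
    -- The reflected vector has third coordinate 1 and is not presented as an element of U₁ ∪ U₂, so
    -- membership in the image is verified through the defining equations.
    rw [range_emb, hp hp']
    refine isLineProj_lineProj (ht hp') ?_ ?_
    · rw [conj_one, mul_one', mul_one', conj_mul, conj_conj, mul_conj_mul]
    · rw [conj_one, mul_one', mul_one', mul_conj_mul]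
  refine ⟨F, h1, h2, h3, fun p hp' => ?_⟩
  have hF : F p ∈ D₃ := by
    rw [mem_D₃_iff, h1]; exact mem_D₃_iff.1 hp'
  exact ⟨hF, by rw [φ₃_eq hF, h1, hp hp', lineProj_one_right_coords (ht hp').ne']⟩

theorem extendsToUnique {D : Set OP11} {φ : OP11 → OctPair} {f : OctPair → OctPair}
    (hD : Dense D) (hφ : Set.InjOn φ D) {F : Equiv.Perm OP11} (hF : metric.IsIsometry F)
    (hFF : F * F = 1) (h : Extends F D φ f) : ExtendsToUniqueInvolutiveIsometry metric D φ f :=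
  ⟨F, hF, h, hFF, fun _ hF' h' => perm_eq_of_extends hD hφ hF.1.continuous hF'.1.continuous h h'⟩

/-! ### Transitivity -/

/-- The group generated by the reflections. -/
def reflectionGroup : Subgroup (Equiv.Perm OP11) :=
  Subgroup.closure {F : Equiv.Perm OP11 | metric.IsIsometry F ∧ ExtendsReflection F}

/-- The Euclidean reflection with r = 0, λ = 1 exchanges the first two coordinates. -/
theorem exists_mem_D₁ (p : OP11) : ∃ F ∈ reflectionGroup, F p ∈ D₁ := by
  by_cases hp : p ∈ D₁
  · exact ⟨1, one_mem _, hp⟩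
  · have h : (0 : ℝ) ^ 2 + ‖(1 : Octonion)‖ ^ 2 = 1 := by rw [norm_one']; norm_num
    obtain ⟨F, h1, h2, -, h3⟩ := exists_euclRefl h
    refine ⟨F, Subgroup.subset_closure ⟨h2, Or.inr ⟨_, _, h, h3⟩⟩, ?_⟩
    have h4 := mem_D₂_iff.1 ((mem_D₁_or_D₂ p).resolve_left hp)
    rw [mem_D₁_iff, h1]
    simpa [euclHerm, norm_one'] using h4

/-- On (1, u, v) the Euclidean reflection with λ = r ū has second coordinate λ̄ - ru = 0; the
condition r² + |λ|² = 1 then fixes r² = 1 / (1 + |u|²). -/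
theorem exists_notMem_D₂ {p : OP11} (hp : p ∈ D₁) : ∃ F ∈ reflectionGroup, F p ∉ D₂ := by
  obtain ⟨⟨⟨u, v⟩, hw⟩, rfl⟩ := mem_D₁.1 hp
  obtain ⟨r, hr⟩ : ∃ r : ℝ, r ^ 2 * (1 + ‖u‖ ^ 2) = 1 :=
    ⟨(√(1 + ‖u‖ ^ 2))⁻¹, by
      rw [inv_pow, Real.sq_sqrt (by positivity), inv_mul_cancel₀ (by positivity)]⟩
  have h : r ^ 2 + ‖r • conj u‖ ^ 2 = 1 := by
    rw [norm_smul, mul_pow, Real.norm_eq_abs, sq_abs, norm_conj]; linarith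
  obtain ⟨F, h1, h2, -, h3⟩ := exists_euclRefl h
  refine ⟨F, Subgroup.subset_closure ⟨h2, Or.inr ⟨_, _, h, h3⟩⟩, ?_⟩
  rw [mem_D₂_iff, h1, not_not, emb_pt₁, param, lineProj, map_smul]
  simp only [euclHerm, outer, LinearMap.coe_mk, AddHom.coe_mk, Prod.smul_mk, smul_eq_mul, one_mul',
    norm_one', real_inner_smul_left, real_inner_self_eq_norm_sq, norm_smul, norm_conj, mul_pow,
    Real.norm_eq_abs, sq_abs]
  ring

theorem eq_base {p : OP11} (h1 : (emb p).2.1 = 0) (h2 : (emb p).2.2.1 = 0) :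
    p = pt₁ ⟨0, zero_mem_target⟩ := by
  have hp : p ∉ D₂ := fun h => mem_D₂_iff.1 h h1
  obtain ⟨⟨⟨u, v⟩, hw⟩, rfl⟩ := mem_D₁.1 ((mem_D₁_or_D₂ p).resolve_right hp)
  have hu : u = 0 := by
    by_contra hu
    exact hp (cls_mem_D₂.2 hu)
  have hv : v = 0 := by
    by_contra hv
    exact mem_D₃_iff.1 ⟨_, hv, rfl⟩ h2
  subst hu hv; rfl

/-- The point is [1, 0, v] with |v| < 1. The indefinite reflection of the second patch acts on the
first and third coordinates and fixes the second; with λ = r v̄ the third becomes -λ̄ + rv = 0, and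
r² - |λ|² = 1 fixes r² = 1 / (1 - |v|²). -/
theorem exists_eq_base {p : OP11} (hp : p ∉ D₂) :
    ∃ F ∈ reflectionGroup, F p = pt₁ ⟨0, zero_mem_target⟩ := by
  have hβ : (emb p).2.1 = 0 := not_not.1 (mt mem_D₂_iff.2 hp)
  obtain ⟨⟨⟨u, v⟩, hw⟩, rfl⟩ := mem_D₁.1 ((mem_D₁_or_D₂ p).resolve_right hp)
  have hu : u = 0 := by
    by_contra hu
    exact hp (cls_mem_D₂.2 hu)
  subst hu
  have hv : 0 < 1 - ‖v‖ ^ 2 := by simpa [target] using hw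
  obtain ⟨r, hr⟩ : ∃ r : ℝ, r ^ 2 * (1 - ‖v‖ ^ 2) = 1 :=
    ⟨(√(1 - ‖v‖ ^ 2))⁻¹, by rw [inv_pow, Real.sq_sqrt hv.le, inv_mul_cancel₀ hv.ne']⟩
  have h : r ^ 2 - ‖r • conj v‖ ^ 2 = 1 := by
    rw [norm_smul, mul_pow, Real.norm_eq_abs, sq_abs, norm_conj]; linarith
  obtain ⟨F, h1, h2, -, h3⟩ := exists_indefRefl₂ h
  refine ⟨F, Subgroup.subset_closure ⟨h2, Or.inl ⟨_, _, h, Or.inr h3⟩⟩, eq_base ?_ ?_⟩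
  · rw [h1]; exact hβ
  · rw [h1, emb_pt₁, param, lineProj, map_smul]
    simp only [indefHerm'_apply, swapHerm, indefHerm, outer, LinearMap.coe_mk, AddHom.coe_mk,
      Prod.smul_mk, smul_eq_mul, one_mul', norm_one', real_inner_smul_left,
      real_inner_self_eq_norm_sq, norm_smul, norm_conj, mul_pow, Real.norm_eq_abs, sq_abs]
    ring

theorem reflectionGroup_transitive (p q : OP11) : ∃ F ∈ reflectionGroup, F p = q := by
  have key (p : OP11) : ∃ F ∈ reflectionGroup, F p = pt₁ ⟨0, zero_mem_target⟩ := by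
    obtain ⟨F, hF, h1⟩ := exists_mem_D₁ p
    obtain ⟨G, hG, h2⟩ := exists_notMem_D₂ h1
    obtain ⟨H, hH, h3⟩ := exists_eq_base h2
    exact ⟨H * (G * F), mul_mem hH (mul_mem hG hF), h3⟩
  obtain ⟨F, hF, h1⟩ := key p
  obtain ⟨G, hG, h2⟩ := key q
  exact ⟨G⁻¹ * F, mul_mem (inv_mem hG) hF, by
    rw [Equiv.Perm.mul_apply, h1, ← h2]; exact G.symm_apply_apply q⟩

theorem reflectionGroup_le : reflectionGroup ≤ metric.isometryGroup :=
  (Subgroup.closure_le _).2 fun _ hF => hF.1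

end OP11
end

theorem mainTheorem10 :
    ∃ g : SemiRiemannianMetric OctPair OP11,
      OP11.IsGivenByDsSq g ∧
      (∀ g' : SemiRiemannianMetric OctPair OP11, OP11.IsGivenByDsSq g' → g' = g) ∧
      g.HasSignature 8 8 ∧
      (∀ (r : ℝ) (l : Octonion), r ^ 2 - ‖l‖ ^ 2 = 1 →
        OP11.ExtendsToUniqueInvolutiveIsometry g OP11.D₁ OP11.φ₁ (OP11.indefRefl r l) ∧
        OP11.ExtendsToUniqueInvolutiveIsometry g OP11.D₂ OP11.φ₂ (OP11.indefRefl r l)) ∧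
      (∀ (r : ℝ) (l : Octonion), r ^ 2 + ‖l‖ ^ 2 = 1 →
        OP11.ExtendsToUniqueInvolutiveIsometry g OP11.D₃ OP11.φ₃ (OP11.euclRefl r l)) ∧
      (∀ p q : OP11, ∃ F ∈ Subgroup.closure
        {F : Equiv.Perm OP11 | g.IsIsometry F ∧ OP11.ExtendsReflection F}, F p = q) ∧
      MulAction.IsPretransitive g.isometryGroup OP11 := by
  refine ⟨OP11.metric, OP11.isGivenByDsSq_metric,
    fun g' h => OP11.eq_of_isGivenByDsSq h OP11.isGivenByDsSq_metric, OP11.hasSignature_metric,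
    fun r l h => ⟨?_, ?_⟩, fun r l h => ?_, OP11.reflectionGroup_transitive, ⟨fun p q => ?_⟩⟩
  · obtain ⟨F, -, hF, hFF, hE⟩ := OP11.exists_indefRefl₁ h
    exact OP11.extendsToUnique OP11.dense_D₁ OP11.chart₁.injOn hF hFF hE
  · obtain ⟨F, -, hF, hFF, hE⟩ := OP11.exists_indefRefl₂ h
    exact OP11.extendsToUnique OP11.dense_D₂ OP11.chart₂.injOn hF hFF hE
  · obtain ⟨F, -, hF, hFF, hE⟩ := OP11.exists_euclRefl h
    exact OP11.extendsToUnique OP11.dense_D₃ OP11.injOn_φ₃ hF hFF hE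
  · obtain ⟨F, hF, h⟩ := OP11.reflectionGroup_transitive p q
    exact ⟨⟨F, OP11.reflectionGroup_le hF⟩, h⟩
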